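/- Let $M$ be a connected smooth 2-dimensional manifold and let $\sigma$ be a smooth symmetric 4-vector on $M$, i.e. a smooth section of $S^4(TM)$. In a local frame $e_1,e_2$ of $TM$ write $$\sigma=a_0e_1^4+4a_1e_1^3e_2+6a_2e_1^2e_2^2+4a_3e_1e_2^3+a_4e_2^4,$$ $$\mathcal I_2=a_0a_4-4a_1a_3+3a_2^2,\qquad \mathcal I_3=a_0a_2a_4-a_0a_3^2-a_1^2a_4+2a_1a_2a_3-a_2^3 .$$ Assume that $\sigma$ is regular, i.e. that its discriminant $256(\mathcal I_2^3-27\mathcal I_3^2)$ vanishes nowhere. Let $I_0=\mathcal I_3^2/\mathcal I_2^3$, with value $\infty$ at the points where $\mathcal I_2=0$ (there $\mathcal I_3\ne 0$); it does not depend on the frame. One says that $\sigma$ has constant type if there is a $\mathrm{GL}(2,\mathbb R)$-orbit $\varpi\subset S^4(\mathbb R^2)$, consisting of tensors with non-zero discriminant, such that $\varphi_*(\sigma_q)\in\varpi$ for every $q\in M$ and every linear isomorphism $\varphi:T_qM\to\mathbb R^2$. Theorem. The following are equivalent: 1. $\sigma$ has constant type; 2. $I_0$ is constant on $M$, as a function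 with values in $\mathbb R\cup\{\infty\}$; 3. there is a smooth linear connection $\nabla^\sigma$ in the tangent bundle of $M$ such that $\nabla^\sigma_X\sigma=0$ for all vector fields $X$ on $M$. A connection as in 3 (the Wagner connection of $\sigma$) is unique if it exists. -/

import Mathlib

open Bundle
open scoped Manifold ContDiff

/-- The coordinate plane on which surfaces are modelled. -/
abbrev Plane : Type := EuclideanSpace ℝ (Fin 2)

/-! ## Symmetric 4-vectors on a two-dimensional vector space -/

section Algebra

variable (V : Type*) [AddCommGroup V] [Module ℝ V] [TopologicalSpace V]

/-- The cotangent (dual) space. -/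
abbrev Covector : Type _ := V →L[ℝ] ℝ

/-- Contravariant 4-tensors, as 4-linear forms on covectors. -/
abbrev FourTensor : Type _ := MultilinearMap ℝ (fun _ : Fin 4 ↦ Covector V) ℝ

variable {V}

/-- Symmetry of a contravariant 4-tensor: the elements of `S^4 V` are the symmetric 4-tensors. -/
def FourTensor.IsSymm (s : FourTensor V) : Prop :=
  ∀ (p : Equiv.Perm (Fin 4)) (ξ : Fin 4 → Covector V), s (fun i ↦ ξ (p i)) = s ξ

/-- The push-forward `(φ_* s)(ξ₀, …, ξ₃) = s(ξ₀ ∘ φ, …, ξ₃ ∘ φ)` of a 4-tensor along a linear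
isomorphism. -/
def FourTensor.push {V W : Type*}
    [AddCommGroup V] [Module ℝ V] [TopologicalSpace V]
    [AddCommGroup W] [Module ℝ W] [TopologicalSpace W]
    (φ : V ≃L[ℝ] W) (s : FourTensor V) : FourTensor W :=
  MultilinearMap.compLinearMap s fun _ ↦
    { toFun := fun ξ : Covector W ↦ (ξ.comp (φ : V →L[ℝ] W) : Covector V)
      map_add' := fun _ _ ↦ rfl
      map_smul' := fun _ _ ↦ rfl }

theorem FourTensor.push_apply {V W : Type*}
    [AddCommGroup V] [Module ℝ V] [TopologicalSpace V]
    [AddCommGroup W] [Module ℝ W] [TopologicalSpace W]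
    (φ : V ≃L[ℝ] W) (s : FourTensor V) (ξ : Fin 4 → Covector W) :
    FourTensor.push φ s ξ = s (fun i ↦ (ξ i).comp (φ : V →L[ℝ] W)) := rfl

/-- The coefficients `a₀, …, a₄` of
`a₀ e₁⁴ + 4 a₁ e₁³e₂ + 6 a₂ e₁²e₂² + 4 a₃ e₁e₂³ + a₄ e₂⁴`. -/
structure QuarticCoeffs where
  a₀ : ℝ
  a₁ : ℝ
  a₂ : ℝ
  a₃ : ℝ
  a₄ : ℝ

namespace QuarticCoeffs

/-- The relative invariant of weight 2. -/
def I₂ (a : QuarticCoeffs) : ℝ := a.a₀ * a.a₄ - 4 * a.a₁ * a.a₃ + 3 * a.a₂ ^ 2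

/-- The relative invariant of weight 3. -/
def I₃ (a : QuarticCoeffs) : ℝ :=
  a.a₀ * a.a₂ * a.a₄ - a.a₀ * a.a₃ ^ 2 - a.a₁ ^ 2 * a.a₄ + 2 * a.a₁ * a.a₂ * a.a₃ - a.a₂ ^ 3

/-- The discriminant of the binary quartic form
`a₀ x⁴ + 4 a₁ x³y + 6 a₂ x²y² + 4 a₃ xy³ + a₄ y⁴`. -/
def discr (a : QuarticCoeffs) : ℝ := 256 * (a.I₂ ^ 3 - 27 * a.I₃ ^ 2)

/-- If the quartic form is a product of complex linear forms `p i * x - q i * y`, then its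
discriminant is the product of the squares of the `2 × 2` determinants of these factors. (So for a
nonzero form it vanishes exactly when there is a multiple root in the projective line.) -/
theorem discr_eq_prod_of_factorization (a : QuarticCoeffs) (p q : Fin 4 → ℂ)
    (h : ∀ x y : ℂ, (a.a₀ : ℂ) * x ^ 4 + 4 * a.a₁ * x ^ 3 * y + 6 * a.a₂ * x ^ 2 * y ^ 2 +
      4 * a.a₃ * x * y ^ 3 + a.a₄ * y ^ 4 = ∏ i, (p i * x - q i * y)) :
    (a.discr : ℂ) =
      ((p 0 * q 1 - p 1 * q 0) * (p 0 * q 2 - p 2 * q 0) * (p 0 * q 3 - p 3 * q 0) *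
        (p 1 * q 2 - p 2 * q 1) * (p 1 * q 3 - p 3 * q 1) * (p 2 * q 3 - p 3 * q 2)) ^ 2 := by
  have h0 : (a.a₀ : ℂ) = p 0 * p 1 * p 2 * p 3 := by
    have := h 1 0
    simp [Fin.prod_univ_four] at this
    exact this
  have h4 : (a.a₄ : ℂ) = q 0 * q 1 * q 2 * q 3 := by
    have := h 0 1
    simp [Fin.prod_univ_four] at this
    exact this
  have e1 := h 1 1
  have e2 := h 1 (-1)
  have e3 := h 2 1
  simp only [Fin.prod_univ_four] at e1 e2 e3
  have h2 : (a.a₂ : ℂ) = (p 0 * p 1 * q 2 * q 3 + p 0 * p 2 * q 1 * q 3 + p 0 * p 3 * q 1 * q 2 +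
      p 1 * p 2 * q 0 * q 3 + p 1 * p 3 * q 0 * q 2 + p 2 * p 3 * q 0 * q 1) / 6 := by
    linear_combination (1 / 12) * e1 + (1 / 12) * e2 - (1 / 6) * h0 - (1 / 6) * h4
  have h1 : (a.a₁ : ℂ) = -(p 0 * p 1 * p 2 * q 3 + p 0 * p 1 * p 3 * q 2 + p 0 * p 2 * p 3 * q 1 +
      p 1 * p 2 * p 3 * q 0) / 4 := by
    linear_combination (1 / 24) * e3 - (1 / 24) * (16 * h0 + 24 * h2 + h4)
      - (1 / 24) * (e1 - e2)
  have h3 : (a.a₃ : ℂ) = -(p 0 * q 1 * q 2 * q 3 + p 1 * q 0 * q 2 * q 3 + p 2 * q 0 * q 1 * q 3 +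
      p 3 * q 0 * q 1 * q 2) / 4 := by
    linear_combination (1 / 8) * (e1 - e2) - h1
  simp only [discr, I₂, I₃]
  push_cast
  rw [h0, h1, h2, h3, h4]
  ring

/-- The absolute invariant `I₀ = I₃² / I₂³`, with value in the projective line `ℝ ∪ {∞}`:
a regular quartic may have `I₂ = 0` (and then `I₃ ≠ 0`), where `I₀ = ∞`. -/
noncomputable def I₀ (a : QuarticCoeffs) : OnePoint ℝ :=
  open Classical in
  if a.I₂ = 0 then OnePoint.infty else ((a.I₃ ^ 2 / a.I₂ ^ 3 : ℝ) : OnePoint ℝ)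

end QuarticCoeffs

/-- The coefficients `a₀, …, a₄` of a symmetric 4-tensor in the basis `e₁, e₂` of `V` that a linear
isomorphism `φ : V → ℝ²` maps to the standard basis: `a k` is the value of the tensor on `4 - k`
copies of `ε 0` and `k` copies of `ε 1`, where `ε 0, ε 1` is the dual basis of `e₁, e₂`. -/
noncomputable def FourTensor.coeffs (s : FourTensor V) (φ : V ≃L[ℝ] Plane) : QuarticCoeffs :=
  let ε : Fin 2 → Covector V := fun i ↦
    (EuclideanSpace.proj i : Plane →L[ℝ] ℝ).comp (φ : V →L[ℝ] Plane)
  { a₀ := s ![ε 0, ε 0, ε 0, ε 0]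
    a₁ := s ![ε 0, ε 0, ε 0, ε 1]
    a₂ := s ![ε 0, ε 0, ε 1, ε 1]
    a₃ := s ![ε 0, ε 1, ε 1, ε 1]
    a₄ := s ![ε 1, ε 1, ε 1, ε 1] }

/-- A 4-tensor on a plane is regular if its discriminant (in any basis) does not vanish. -/
def FourTensor.IsRegular (s : FourTensor V) : Prop :=
  ∀ φ : V ≃L[ℝ] Plane, (s.coeffs φ).discr ≠ 0

end Algebra

/-- The `GL(V)`-orbits of the regular elements of `S^4 V`, for `V = ℝ²`. -/
def IsRegularOrbit (w : Set (FourTensor Plane)) : Prop :=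
  ∃ s : FourTensor Plane, s.IsSymm ∧ s.IsRegular ∧
    w = Set.range fun g : Plane ≃L[ℝ] Plane ↦ s.push g

/-! ## Symmetric 4-vectors on a surface -/

section Surface

variable {M : Type*} [TopologicalSpace M] [ChartedSpace Plane M] [IsManifold (𝓡 2) ∞ M]

/-- 1-forms on a surface (not assumed continuous). -/
abbrev OneForm (M : Type*) [TopologicalSpace M] [ChartedSpace Plane M] : Type _ :=
  ∀ x : M, TangentSpace (𝓡 2) x →L[ℝ] ℝ

/-- The 1-form `ξ` is smooth at `x`, as a section of the cotangent bundle. -/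
def OneForm.SmoothAt (ξ : OneForm M) (x : M) : Prop :=
  ContMDiffAt (𝓡 2) ((𝓡 2).prod 𝓘(ℝ, Plane →L[ℝ] ℝ)) ∞
    (fun y ↦ TotalSpace.mk' (Plane →L[ℝ] ℝ)
      (E := fun y : M ↦ TangentSpace (𝓡 2) y →L[ℝ] ℝ) y (ξ y)) x

/-- The 1-form `ξ` is differentiable at `x`, as a section of the cotangent bundle. -/
def OneForm.DiffAt (ξ : OneForm M) (x : M) : Prop :=
  MDifferentiableAt (𝓡 2) ((𝓡 2).prod 𝓘(ℝ, Plane →L[ℝ] ℝ))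
    (fun y ↦ TotalSpace.mk' (Plane →L[ℝ] ℝ)
      (E := fun y : M ↦ TangentSpace (𝓡 2) y →L[ℝ] ℝ) y (ξ y)) x

/-- Smooth symmetric 4-vectors (symbols) on a surface. Smoothness of the tensor field is tested on
(local) smooth 1-forms. -/
structure SymmFourVector (M : Type*) [TopologicalSpace M] [ChartedSpace Plane M]
    [IsManifold (𝓡 2) ∞ M] where
  toFun : ∀ x : M, FourTensor (TangentSpace (𝓡 2) x)
  symm : ∀ x, (toFun x).IsSymm
  smooth : ∀ (x : M) (ξ : Fin 4 → OneForm M), (∀ i, (ξ i).SmoothAt x) →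
    ContMDiffAt (𝓡 2) 𝓘(ℝ, ℝ) ∞ (fun y ↦ toFun y (fun i ↦ ξ i y)) x

namespace SymmFourVector

/-- A symmetric 4-vector is regular if its discriminant vanishes nowhere. -/
def IsRegular (σ : SymmFourVector M) : Prop := ∀ x : M, (σ.toFun x).IsRegular

/-- `σ` has constant type `w`: every linear isomorphism `T_x M → ℝ²`, at every point `x`,
maps `σ_x` into `w`. -/
def HasType (σ : SymmFourVector M) (w : Set (FourTensor Plane)) : Prop :=
  ∀ (x : M) (φ : TangentSpace (𝓡 2) x ≃L[ℝ] Plane), (σ.toFun x).push φ ∈ w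

/-- `σ` has constant type. -/
def HasConstantType (σ : SymmFourVector M) : Prop :=
  ∃ w, IsRegularOrbit w ∧ σ.HasType w

/-- The invariant `I₀` of `σ`, computed in any frame at any point, is one and the same constant. -/
def HasConstantI₀ (σ : SymmFourVector M) : Prop :=
  ∃ c : OnePoint ℝ, ∀ (x : M) (φ : TangentSpace (𝓡 2) x ≃L[ℝ] Plane),
    ((σ.toFun x).coeffs φ).I₀ = c

end SymmFourVector

/-- Vector fields on a surface (not assumed continuous). -/
abbrev VectFld (M : Type*) [TopologicalSpace M] [ChartedSpace Plane M] : Type _ :=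
  ∀ x : M, TangentSpace (𝓡 2) x

/-- The vector field `Y` is differentiable at `x`, as a section of the tangent bundle. -/
def VectFld.DiffAt (Y : VectFld M) (x : M) : Prop :=
  MDifferentiableAt (𝓡 2) ((𝓡 2).prod 𝓘(ℝ, Plane))
    (fun y ↦ TotalSpace.mk' Plane (E := fun y : M ↦ TangentSpace (𝓡 2) y) y (Y y)) x

theorem OneForm.DiffAt.apply_vectorField {ξ : OneForm M} {x : M} (hξ : ξ.DiffAt x)
    {Y : VectFld M} (hY : Y.DiffAt x) :
    MDifferentiableAt (𝓡 2) 𝓘(ℝ, ℝ) (fun y ↦ ξ y (Y y)) x := by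
  have h : MDifferentiableAt (𝓡 2) ((𝓡 2).prod 𝓘(ℝ, ℝ))
      (fun y ↦ TotalSpace.mk' ℝ (E := Bundle.Trivial M ℝ) y (ξ y (Y y))) x :=
    MDifferentiableAt.clm_bundle_apply (F₁ := Plane) (F₂ := ℝ) (b := fun y : M ↦ y) (v := Y)
      (E₁ := fun y : M ↦ TangentSpace (𝓡 2) y) (E₂ := Bundle.Trivial M ℝ) (ϕ := ξ) hξ hY
  exact ((mdifferentiableAt_totalSpace _ _).1 h).2

/-- Linear connections in the tangent bundle of a surface (covariant derivatives; smoothness is a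
separate condition). -/
abbrev TangentConnection (M : Type*) [TopologicalSpace M] [ChartedSpace Plane M]
    [IsManifold (𝓡 2) ∞ M] : Type _ :=
  CovariantDerivative (𝓡 2) Plane (fun x : M ↦ TangentSpace (𝓡 2) x)

namespace TangentConnection

/-- `Y ↦ X₀(ξ(Y)) - ξ(∇_{X₀} Y)` at the point `x`. -/
noncomputable def dualAux (cov : TangentConnection M) (ξ : OneForm M) (x : M)
    (X₀ : TangentSpace (𝓡 2) x) (Y : VectFld M) : ℝ :=
  mvfderiv (𝓡 2) (fun y ↦ ξ y (Y y)) x X₀ - ξ x (cov Y x X₀)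

theorem dualAux_tensorial (cov : TangentConnection M) {ξ : OneForm M} {x : M}
    (hξ : ξ.DiffAt x) (X₀ : TangentSpace (𝓡 2) x) :
    TensorialAt (𝓡 2) Plane (cov.dualAux ξ x X₀) x where
  smul {f Y} hf hY := by
    have hg := hξ.apply_vectorField hY
    have e : (fun y ↦ ξ y ((f • Y) y)) = fun y ↦ f y * ξ y (Y y) := by
      funext y; simp
    simp only [dualAux, e, mvfderiv_fun_mul hf hg, cov.isCovariantDerivativeOn.leibniz hY hf]
    simp
    ring
  add {Y Y'} hY hY' := by
    have e : (fun y ↦ ξ y ((Y + Y') y)) = fun y ↦ ξ y (Y y) + ξ y (Y' y) := by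
      funext y; simp
    simp only [dualAux, e, mvfderiv_fun_add (hξ.apply_vectorField hY) (hξ.apply_vectorField hY'),
      cov.isCovariantDerivativeOn.add hY hY']
    simp
    ring

/-- The covariant derivative `∇_{X₀} ξ` at `x` of a 1-form `ξ` differentiable at `x`, for the dual
connection: `(∇_{X₀} ξ)(Y) = X₀(ξ(Y)) - ξ(∇_{X₀} Y)`. -/
noncomputable def dual (cov : TangentConnection M) {ξ : OneForm M} {x : M}
    (hξ : ξ.DiffAt x) (X₀ : TangentSpace (𝓡 2) x) : TangentSpace (𝓡 2) x →L[ℝ] ℝ :=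
  TensorialAt.mkHom (cov.dualAux ξ x X₀) x (cov.dualAux_tensorial hξ X₀)

theorem dual_apply (cov : TangentConnection M) {ξ : OneForm M} {x : M}
    (hξ : ξ.DiffAt x) (X₀ : TangentSpace (𝓡 2) x) {Y : VectFld M}
    (hY : Y.DiffAt x) :
    cov.dual hξ X₀ (Y x) = mvfderiv (𝓡 2) (fun y ↦ ξ y (Y y)) x X₀ - ξ x (cov Y x X₀) :=
  TensorialAt.mkHom_apply _ hY

/-- `(∇_{X₀} σ)(ξ₀, …, ξ₃) = X₀(σ(ξ₀, …, ξ₃)) - ∑ i, σ(ξ₀, …, ∇_{X₀} ξ i, …, ξ₃)` at `x`, for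
1-forms `ξ i` that are differentiable at `x`. -/
noncomputable def derivFourVector (cov : TangentConnection M) (σ : SymmFourVector M) {x : M}
    (X₀ : TangentSpace (𝓡 2) x) {ξ : Fin 4 → OneForm M} (hξ : ∀ i, (ξ i).DiffAt x) : ℝ :=
  mvfderiv (𝓡 2) (fun y ↦ σ.toFun y (fun i ↦ ξ i y)) x X₀ -
    ∑ i, σ.toFun x (Function.update (fun j ↦ ξ j x) i (cov.dual (hξ i) X₀))

/-- `∇` is a Wagner connection of `σ`: a smooth linear connection in the tangent bundle such that
`∇_X σ = 0` for all `X`. -/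
structure IsWagner (cov : TangentConnection M) (σ : SymmFourVector M) : Prop where
  smooth : cov.ContMDiffCovariantDerivative ∞
  parallel : ∀ (x : M) (X₀ : TangentSpace (𝓡 2) x) (ξ : Fin 4 → OneForm M)
    (hξ : ∀ i, (ξ i).DiffAt x), cov.derivFourVector σ X₀ hξ = 0

end TangentConnection

end Surface

/-! ## Binary quartics: invariants and the action of `2 × 2` matrices

A binary quartic is represented by the vector of its coefficients `a 0, …, a 4`. -/

/-! In a local frame `σ` is a vector `a` of five coefficient functions, and `∇_X σ = 0` becomes
`X(a) + infAct a (Γ X) = 0` (`parallel_iff`), a linear equation at each point for the matrix `Γ X`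
of connection coefficients. Everything rests on the infinitesimal action `infAct a` of `gl(2)` at a
regular quartic `a`. It is injective, and its image, the tangent space of the orbit, is the
hyperplane `dI₀ a = 0` in the five-dimensional space of quartics. Both facts come from explicit
polynomial identities, `infActInv_infAct` and `infAct_infActInv`.

Injectivity gives a closed formula for `Γ X` (`christoffel_eq_of_parallel`), rational in `a` and
linear in `X(a)`; hence uniqueness and smoothness. If `I₀` is constant, then `dI₀ a` kills `X(a)`
and the formula solves the equation. Conversely, for a parallel `σ` the derivatives `X(a)` are
tangent to orbits, so the invariant `J`, a finite substitute for `I₀`, has zero derivative and is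
constant by connectedness.

A level set of `I₀` may contain several real orbits (`x⁴ + y⁴` and its negative, for instance), so
constancy of `I₀` gives constant type only through a local argument. The orbit directions and the
Hessian of `a` span all quartics, and `I₀` leaves its value along the Hessian pencil; so each
regular orbit is open in its level set (`eventually_exists_act_eq`). Symbols at nearby points are
therefore equivalent, and connectedness does the rest. -/

namespace BinaryQuartic

/-- The invariant of degree 2. -/
def I₂ (a : Fin 5 → ℝ) : ℝ := a 0 * a 4 - 4 * a 1 * a 3 + 3 * a 2 ^ 2

/-- The invariant of degree 3. -/
def I₃ (a : Fin 5 → ℝ) : ℝ :=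
  a 0 * a 2 * a 4 - a 0 * a 3 ^ 2 - a 1 ^ 2 * a 4 + 2 * a 1 * a 2 * a 3 - a 2 ^ 3

/-- The discriminant, up to the factor `256`. -/
def disc (a : Fin 5 → ℝ) : ℝ := I₂ a ^ 3 - 27 * I₃ a ^ 2

/-- The differential of `I₂` at `a`. -/
def dI₂ (a c : Fin 5 → ℝ) : ℝ :=
  a 0 * c 4 + c 0 * a 4 - 4 * (a 1 * c 3 + c 1 * a 3) + 6 * a 2 * c 2

/-- The differential of `I₃` at `a`. -/
def dI₃ (a c : Fin 5 → ℝ) : ℝ :=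
  c 0 * (a 2 * a 4 - a 3 ^ 2) + c 1 * (2 * a 2 * a 3 - 2 * a 1 * a 4) +
    c 2 * (a 0 * a 4 + 2 * a 1 * a 3 - 3 * a 2 ^ 2) + c 3 * (2 * a 1 * a 2 - 2 * a 0 * a 3) +
    c 4 * (a 0 * a 2 - a 1 ^ 2)

/-- The linear form `2 I₂ dI₃ - 3 I₃ dI₂`, proportional to the differential of `I₃² / I₂³`. -/
def dI₀ (a c : Fin 5 → ℝ) : ℝ := 2 * I₂ a * dI₃ a c - 3 * I₃ a * dI₂ a c

/-- The coefficients of the linear form `dI₀`. -/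
def gradI₀ (a : Fin 5 → ℝ) : Fin 5 → ℝ :=
  ![2 * I₂ a * (a 2 * a 4 - a 3 ^ 2) - 3 * I₃ a * a 4,
    4 * I₂ a * (a 2 * a 3 - a 1 * a 4) + 12 * I₃ a * a 3,
    2 * I₂ a * (a 0 * a 4 + 2 * a 1 * a 3 - 3 * a 2 ^ 2) - 18 * I₃ a * a 2,
    4 * I₂ a * (a 1 * a 2 - a 0 * a 3) + 12 * I₃ a * a 1,
    2 * I₂ a * (a 0 * a 2 - a 1 ^ 2) - 3 * I₃ a * a 0]

/-- The Hessian covariant. -/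
noncomputable def hess (a : Fin 5 → ℝ) : Fin 5 → ℝ :=
  ![a 0 * a 2 - a 1 ^ 2, (a 0 * a 3 - a 1 * a 2) / 2,
    (a 0 * a 4 + 2 * a 1 * a 3 - 3 * a 2 ^ 2) / 6, (a 1 * a 4 - a 2 * a 3) / 2,
    a 2 * a 4 - a 3 ^ 2]

theorem dI₀_eq_sum (a c : Fin 5 → ℝ) : dI₀ a c = ∑ k, gradI₀ a k * c k := by
  simp [Fin.sum_univ_five, dI₀, gradI₀, dI₂, dI₃]
  ring

/-- For a regular quartic the Hessian thus supplies the one direction missing from the tangent space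
of the orbit. -/
theorem dI₀_hess (a : Fin 5 → ℝ) : dI₀ a (hess a) = disc a / 3 := by
  simp [dI₀, dI₂, dI₃, disc, I₂, I₃, hess]
  ring

theorem I₂_add_smul_hess (a : Fin 5 → ℝ) (t : ℝ) :
    I₂ (a + t • hess a) = I₂ a + t * (3 * I₃ a) + t ^ 2 * (I₂ a ^ 2 / 12) := by
  simp [I₂, I₃, hess]
  ring

theorem I₃_add_smul_hess (a : Fin 5 → ℝ) (t : ℝ) :
    I₃ (a + t • hess a) = I₃ a + t * (I₂ a ^ 2 / 6) + t ^ 2 * (I₂ a * I₃ a / 4) +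
      t ^ 3 * (I₃ a ^ 2 / 4 - I₂ a ^ 3 / 216) := by
  simp [I₂, I₃, hess]
  ring

/-- The infinitesimal action of a `2 × 2` matrix on binary quartics. -/
def infAct (a : Fin 5 → ℝ) (γ : Fin 2 → Fin 2 → ℝ) : Fin 5 → ℝ :=
  ![4 * (γ 0 0 * a 0 + γ 0 1 * a 1),
    3 * (γ 0 0 * a 1 + γ 0 1 * a 2) + (γ 1 0 * a 0 + γ 1 1 * a 1),
    2 * (γ 0 0 * a 2 + γ 0 1 * a 3) + 2 * (γ 1 0 * a 1 + γ 1 1 * a 2),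
    (γ 0 0 * a 3 + γ 0 1 * a 4) + 3 * (γ 1 0 * a 2 + γ 1 1 * a 3),
    4 * (γ 1 0 * a 3 + γ 1 1 * a 4)]

theorem infAct_smul (a : Fin 5 → ℝ) (t : ℝ) (γ : Fin 2 → Fin 2 → ℝ) :
    infAct a (t • γ) = t • infAct a γ := by
  funext k
  fin_cases k <;> (simp [infAct]; ring)

/-- The infinitesimal form of `I₂_act`: the trace is the derivative of the determinant at the
identity. With `dI₃_infAct`, it shows that `dI₀ a` vanishes on the image of `infAct a`. -/
theorem dI₂_infAct (a : Fin 5 → ℝ) (γ : Fin 2 → Fin 2 → ℝ) :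
    dI₂ a (infAct a γ) = 4 * (γ 0 0 + γ 1 1) * I₂ a := by
  simp [dI₂, I₂, infAct]
  ring

theorem dI₃_infAct (a : Fin 5 → ℝ) (γ : Fin 2 → Fin 2 → ℝ) :
    dI₃ a (infAct a γ) = 6 * (γ 0 0 + γ 1 1) * I₃ a := by
  simp [dI₃, I₃, infAct]
  ring

/-- The coefficients of a linear map which, divided by the discriminant, is a left inverse of
`infAct a`. -/
noncomputable def infActInv (a : Fin 5 → ℝ) : Fin 2 → Fin 2 → Fin 5 → ℝ :=
  let p₀ := a 0 ^ 2 * a 4 ^ 3 - 11 * a 0 * a 1 * a 3 * a 4 ^ 2 - 18 * a 0 * a 2 ^ 2 * a 4 ^ 2 +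
    54 * a 0 * a 2 * a 3 ^ 2 * a 4 - 27 * a 0 * a 3 ^ 4 + 36 * a 1 ^ 2 * a 2 * a 4 ^ 2 +
    a 1 ^ 2 * a 3 ^ 2 * a 4 - 153 * a 1 * a 2 ^ 2 * a 3 * a 4 + 90 * a 1 * a 2 * a 3 ^ 3 +
    81 * a 2 ^ 4 * a 4 - 54 * a 2 ^ 3 * a 3 ^ 2
  let q₀ := -a 0 ^ 2 * a 3 * a 4 ^ 2 + 18 * a 0 * a 1 * a 2 * a 4 ^ 2 -
    7 * a 0 * a 1 * a 3 ^ 2 * a 4 - 27 * a 0 * a 2 ^ 2 * a 3 * a 4 + 18 * a 0 * a 2 * a 3 ^ 3 -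
    27 * a 1 ^ 3 * a 4 ^ 2 + 108 * a 1 ^ 2 * a 2 * a 3 * a 4 - 64 * a 1 ^ 2 * a 3 ^ 3 -
    54 * a 1 * a 2 ^ 3 * a 4 + 36 * a 1 * a 2 ^ 2 * a 3 ^ 2
  let p₁ := a 0 ^ 3 * a 4 ^ 2 - 11 * a 0 ^ 2 * a 1 * a 3 * a 4 - 18 * a 0 ^ 2 * a 2 ^ 2 * a 4 +
    36 * a 0 ^ 2 * a 2 * a 3 ^ 2 + 54 * a 0 * a 1 ^ 2 * a 2 * a 4 + a 0 * a 1 ^ 2 * a 3 ^ 2 -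
    153 * a 0 * a 1 * a 2 ^ 2 * a 3 + 81 * a 0 * a 2 ^ 4 - 27 * a 1 ^ 4 * a 4 +
    90 * a 1 ^ 3 * a 2 * a 3 - 54 * a 1 ^ 2 * a 2 ^ 3
  let q₁ := -a 0 ^ 2 * a 1 * a 4 ^ 2 + 18 * a 0 ^ 2 * a 2 * a 3 * a 4 - 27 * a 0 ^ 2 * a 3 ^ 3 -
    7 * a 0 * a 1 ^ 2 * a 3 * a 4 - 27 * a 0 * a 1 * a 2 ^ 2 * a 4 +
    108 * a 0 * a 1 * a 2 * a 3 ^ 2 - 54 * a 0 * a 2 ^ 3 * a 3 + 18 * a 1 ^ 3 * a 2 * a 4 -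
    64 * a 1 ^ 3 * a 3 ^ 2 + 36 * a 1 ^ 2 * a 2 ^ 2 * a 3
  -- For regular `a` the rows of a left inverse are determined only modulo `gradI₀ a`, which
  -- annihilates the image of `infAct a`; this is one choice among many.
  let n := gradI₀ a
  ![![![p₀ / 4, -(3 * a 1 * n 0), -(9 / 8 * a 1 * n 1), -(a 1 * n 2 / 2), -(3 / 16 * a 1 * n 3)],
      ![q₀ / 4, 3 * a 0 * n 0, 9 / 8 * a 0 * n 1, a 0 * n 2 / 2, 3 / 16 * a 0 * n 3]],
    ![![3 / 16 * a 4 * n 1, a 4 * n 2 / 2, 9 / 8 * a 4 * n 3, 3 * a 4 * n 4, q₁ / 4],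
      ![-(3 / 16 * a 3 * n 1), -(a 3 * n 2 / 2), -(9 / 8 * a 3 * n 3), -(3 * a 3 * n 4), p₁ / 4]]]

/-- Where `disc a ≠ 0` this makes `infAct a` injective, the source of the uniqueness of the Wagner
connection. -/
theorem infActInv_infAct (a : Fin 5 → ℝ) (γ : Fin 2 → Fin 2 → ℝ) (i j : Fin 2) :
    ∑ k, infActInv a i j k * infAct a γ k = disc a * γ i j := by
  fin_cases i <;> fin_cases j <;>
    (simp [Fin.sum_univ_five, infActInv, infAct, disc, gradI₀, I₂, I₃]; ring)

/-- A tangent vector to the orbits of `GL(2)` is one annihilated by `dI₀`. -/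
theorem infAct_infActInv {a c : Fin 5 → ℝ} (hc : dI₀ a c = 0) :
    infAct a (fun i j ↦ ∑ k, infActInv a i j k * c k) = disc a • c := by
  simp only [dI₀, dI₂, dI₃, I₂, I₃] at hc
  funext k
  -- The composite minus `disc a` vanishes on the image of `infAct a`, so it has the form `c ↦ dI₀ a
  -- c • v`. The factors of `hc` below are the components of `v`, the first and last being zero.
  fin_cases k <;> simp [Fin.sum_univ_five, infActInv, infAct, disc, gradI₀, I₂, I₃]
  · ring
  · linear_combination (9 / 4 * (a 1 * a 2 - a 0 * a 3)) * hc
  · linear_combination (-(a 0 * a 4) / 2 - 4 * a 1 * a 3 + 9 / 2 * a 2 ^ 2) * hc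
  · linear_combination (9 / 4 * (a 2 * a 3 - a 1 * a 4)) * hc
  · ring

/-- The full polarization of a binary quartic. -/
def polar (a : Fin 5 → ℝ) (u : Fin 4 → Fin 2 → ℝ) : ℝ :=
  ∑ i : Fin 2, ∑ j : Fin 2, ∑ k : Fin 2, ∑ l : Fin 2,
    a ⟨i + j + k + l, by lia⟩ * u 0 i * u 1 j * u 2 k * u 3 l

theorem polar_eq (a : Fin 5 → ℝ) (u : Fin 4 → Fin 2 → ℝ) :
    polar a u = a 0 * (u 0 0 * u 1 0 * u 2 0 * u 3 0) +
      a 1 * (u 0 1 * u 1 0 * u 2 0 * u 3 0 + u 0 0 * u 1 1 * u 2 0 * u 3 0 +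
        u 0 0 * u 1 0 * u 2 1 * u 3 0 + u 0 0 * u 1 0 * u 2 0 * u 3 1) +
      a 2 * (u 0 1 * u 1 1 * u 2 0 * u 3 0 + u 0 1 * u 1 0 * u 2 1 * u 3 0 +
        u 0 1 * u 1 0 * u 2 0 * u 3 1 + u 0 0 * u 1 1 * u 2 1 * u 3 0 +
        u 0 0 * u 1 1 * u 2 0 * u 3 1 + u 0 0 * u 1 0 * u 2 1 * u 3 1) +
      a 3 * (u 0 0 * u 1 1 * u 2 1 * u 3 1 + u 0 1 * u 1 0 * u 2 1 * u 3 1 +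
        u 0 1 * u 1 1 * u 2 0 * u 3 1 + u 0 1 * u 1 1 * u 2 1 * u 3 0) +
      a 4 * (u 0 1 * u 1 1 * u 2 1 * u 3 1) := by
  simp only [polar, Fin.sum_univ_two]
  -- The index sums evaluate definitionally to numerals.
  change a 0 * _ * _ * _ * _ + a 1 * _ * _ * _ * _ + (a 1 * _ * _ * _ * _ + a 2 * _ * _ * _ * _) +
    (a 1 * _ * _ * _ * _ + a 2 * _ * _ * _ * _ + (a 2 * _ * _ * _ * _ + a 3 * _ * _ * _ * _)) +
    (a 1 * _ * _ * _ * _ + a 2 * _ * _ * _ * _ + (a 2 * _ * _ * _ * _ + a 3 * _ * _ * _ * _) +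
    (a 2 * _ * _ * _ * _ + a 3 * _ * _ * _ * _ + (a 3 * _ * _ * _ * _ + a 4 * _ * _ * _ * _))) = _
  ring

/-- The action of a `2 × 2` matrix on binary quartics: the substitution of the rows of the matrix
into the polarization. -/
def act (g : Fin 2 → Fin 2 → ℝ) (a : Fin 5 → ℝ) : Fin 5 → ℝ :=
  ![polar a ![g 0, g 0, g 0, g 0], polar a ![g 0, g 0, g 0, g 1], polar a ![g 0, g 0, g 1, g 1],
    polar a ![g 0, g 1, g 1, g 1], polar a ![g 1, g 1, g 1, g 1]]

/-- The powers of the determinant here and in `I₃_act` make `I₃²` and `I₂³` scale by the same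
twelfth power. -/
theorem I₂_act (g : Fin 2 → Fin 2 → ℝ) (a : Fin 5 → ℝ) :
    I₂ (act g a) = (g 0 0 * g 1 1 - g 0 1 * g 1 0) ^ 4 * I₂ a := by
  simp [I₂, act, polar_eq]
  ring

theorem I₃_act (g : Fin 2 → Fin 2 → ℝ) (a : Fin 5 → ℝ) :
    I₃ (act g a) = (g 0 0 * g 1 1 - g 0 1 * g 1 0) ^ 6 * I₃ a := by
  simp [I₃, act, polar_eq]
  ring

end BinaryQuartic

/-! ## Orbits of binary quartics -/

namespace BinaryQuartic

open Filter Topology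

/-- The absolute invariant `I₃² / I₂³`. -/
noncomputable def I₀ (a : Fin 5 → ℝ) : OnePoint ℝ :=
  open Classical in
  if I₂ a = 0 then OnePoint.infty else ((I₃ a ^ 2 / I₂ a ^ 3 : ℝ) : OnePoint ℝ)

theorem I₀_eq_iff {a b : Fin 5 → ℝ} : I₀ a = I₀ b ↔
    (I₂ a = 0 ∧ I₂ b = 0) ∨
      (I₂ a ≠ 0 ∧ I₂ b ≠ 0 ∧ I₃ a ^ 2 * I₂ b ^ 3 = I₃ b ^ 2 * I₂ a ^ 3) := by
  by_cases ha : I₂ a = 0 <;> by_cases hb : I₂ b = 0 <;> simp [I₀, ha, hb]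
  rw [div_eq_div_iff (pow_ne_zero _ ha) (pow_ne_zero _ hb)]

theorem I₀_act {g : Fin 2 → Fin 2 → ℝ} (hg : g 0 0 * g 1 1 - g 0 1 * g 1 0 ≠ 0) (a : Fin 5 → ℝ) :
    I₀ (act g a) = I₀ a := by
  rw [I₀_eq_iff, I₂_act, I₃_act]
  by_cases ha : I₂ a = 0
  · simp [ha]
  · refine .inr ⟨mul_ne_zero (pow_ne_zero _ hg) ha, ha, ?_⟩
    ring

/-- The absolute invariant `I₂³ / (I₂³ - 27 I₃²)`, which is finite on regular quartics. -/
noncomputable def J (a : Fin 5 → ℝ) : ℝ := I₂ a ^ 3 / disc a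

/-- `J = 1 / (1 - 27 I₀)` is a Möbius function of `I₀` that sends `∞` to `0`, so on regular quartics
it carries the same information and is real-valued. -/
theorem I₀_eq_iff_J_eq {a b : Fin 5 → ℝ} (ha : disc a ≠ 0) (hb : disc b ≠ 0) :
    I₀ a = I₀ b ↔ J a = J b := by
  rw [I₀_eq_iff, J, J, div_eq_div_iff ha hb]
  constructor
  · rintro (⟨h₁, h₂⟩ | ⟨-, -, h⟩)
    · simp [h₁, h₂]
    · rw [disc, disc]
      linear_combination 27 * h
  · intro h
    by_cases h₁ : I₂ a = 0
    · refine .inl ⟨h₁, ?_⟩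
      rw [h₁] at h
      simpa [ha] using h
    · have h₂ : I₂ b ≠ 0 := by
        intro h₂
        rw [h₂] at h
        simp [hb, h₁] at h
      refine .inr ⟨h₁, h₂, ?_⟩
      rw [disc, disc] at h
      linear_combination h / 27

/-- The pencil spanned by a regular quartic and its Hessian is transversal to the level sets of the
absolute invariant. -/
theorem eventually_I₀_add_smul_hess {a : Fin 5 → ℝ} (ha : disc a ≠ 0) :
    ∀ᶠ t in 𝓝 (0 : ℝ), I₀ (a + t • hess a) = I₀ a → t = 0 := by
  -- Equality of the invariants is a polynomial equation in `t` with root `0`; `q` is the cofactor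
  -- of a simple root. When `I₂ a` or `I₃ a` is zero, the equation used is the vanishing of `I₂`,
  -- respectively `I₃`, along the pencil.
  suffices h : ∃ q : ℝ → ℝ, Continuous q ∧ q 0 ≠ 0 ∧
      ∀ t, I₀ (a + t • hess a) = I₀ a → t * q t = 0 by
    obtain ⟨q, hq, hq0, h⟩ := h
    filter_upwards [hq.continuousAt.eventually_ne hq0] with t ht hI
    exact (mul_eq_zero.1 (h t hI)).resolve_right ht
  simp only [I₀_eq_iff, I₂_add_smul_hess, I₃_add_smul_hess]
  by_cases h₂ : I₂ a = 0
  · refine ⟨fun _ ↦ 3 * I₃ a, by fun_prop, ?_, ?_⟩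
    · simpa [disc, h₂] using ha
    · intro t h
      simpa [h₂] using h
  · by_cases h₃ : I₃ a = 0
    · refine ⟨fun t ↦ I₂ a ^ 2 / 6 - t ^ 2 * (I₂ a ^ 3 / 216), by fun_prop, by simpa, ?_⟩
      intro t h
      have h' := (h.resolve_left fun h ↦ h₂ h.2).2.2
      rw [h₃] at h'
      simp [h₂] at h'
      linear_combination h'
    -- This is `I₃(a + t h)² I₂(a)³ - I₃(a)² I₂(a + t h)³`, with `h` the Hessian, divided by `t`. At
    -- `t = 0` it equals `I₃ I₂² disc / 3`, which explains why `I₃ a = 0` was treated separately.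
    · refine ⟨fun t ↦
        (2 * I₃ a + t * (I₂ a ^ 2 / 6 + t * (I₂ a * I₃ a / 4) +
          t ^ 2 * (I₃ a ^ 2 / 4 - I₂ a ^ 3 / 216))) * (I₂ a ^ 2 / 6 + t * (I₂ a * I₃ a / 4) +
          t ^ 2 * (I₃ a ^ 2 / 4 - I₂ a ^ 3 / 216)) * I₂ a ^ 3 -
        I₃ a ^ 2 * (3 * I₃ a + t * (I₂ a ^ 2 / 12)) * ((I₂ a + t * (3 * I₃ a +
          t * (I₂ a ^ 2 / 12))) ^ 2 + (I₂ a + t * (3 * I₃ a + t * (I₂ a ^ 2 / 12))) * I₂ a +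
          I₂ a ^ 2), by fun_prop, ?_, ?_⟩
      · have : I₃ a * I₂ a ^ 2 * disc a ≠ 0 := by positivity
        contrapose! this
        simp only [disc]
        linear_combination 3 * this
      · intro t h
        linear_combination (h.resolve_left fun h ↦ h₂ h.2).2.2

theorem hasDerivAt_polar (a c : Fin 5 → ℝ) (u w : Fin 4 → Fin 2 → ℝ) :
    HasDerivAt (fun s : ℝ ↦ polar (a + s • c) (u + s • w))
      (polar c u + ∑ i, polar a (Function.update u i (w i))) 0 := by
  have h (x y : ℝ) : HasDerivAt (fun s : ℝ ↦ x + s * y) y 0 := by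
    simpa using ((hasDerivAt_id (0 : ℝ)).mul_const y).const_add x
  have h' := HasDerivAt.fun_sum (u := Finset.univ) fun (i : Fin 2) _ ↦
    HasDerivAt.fun_sum (u := Finset.univ) fun (j : Fin 2) _ ↦
    HasDerivAt.fun_sum (u := Finset.univ) fun (k : Fin 2) _ ↦
    HasDerivAt.fun_sum (u := Finset.univ) fun (l : Fin 2) _ ↦
      ((((h (a ⟨i + j + k + l, by lia⟩) (c ⟨i + j + k + l, by lia⟩)).fun_mul
        (h (u 0 i) (w 0 i))).fun_mul (h (u 1 j) (w 1 j))).fun_mul (h (u 2 k) (w 2 k))).fun_mul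
        (h (u 3 l) (w 3 l))
  convert! h' using 1
  simp only [polar, ← Finset.sum_add_distrib, Fin.sum_univ_four]
  refine Finset.sum_congr rfl fun i _ ↦ Finset.sum_congr rfl fun j _ ↦
    Finset.sum_congr rfl fun k _ ↦ Finset.sum_congr rfl fun l _ ↦ ?_
  simp
  ring

/-- Letting `γ` act on one argument at a time is, by duality, the derivation `infAct`. This turns
the four correction terms in `∇σ` into a single quartic. -/
theorem sum_polar_update (a : Fin 5 → ℝ) (γ : Fin 2 → Fin 2 → ℝ) (u : Fin 4 → Fin 2 → ℝ) :
    ∑ i, polar a (Function.update u i fun j ↦ u i 0 * γ 0 j + u i 1 * γ 1 j) =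
      polar (infAct a γ) u := by
  simp [Fin.sum_univ_four, polar_eq, infAct]
  ring

theorem act_one (a : Fin 5 → ℝ) : act (fun i ↦ Pi.single i 1) a = a := by
  funext k
  fin_cases k <;> simp [act, polar_eq]

theorem hasDerivAt_act (a c : Fin 5 → ℝ) (γ : Fin 2 → Fin 2 → ℝ) :
    HasDerivAt (fun s : ℝ ↦ act ((fun i ↦ Pi.single i 1) + s • γ) (a + s • c))
      (c + infAct a γ) 0 := by
  let e : Fin 2 → Fin 2 → ℝ := fun i ↦ Pi.single i 1
  have h (r : Fin 4 → Fin 2) := hasDerivAt_polar a c (fun i ↦ e (r i)) (fun i ↦ γ (r i))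
  rw [hasDerivAt_pi]
  intro k
  fin_cases k
  · convert! h ![0, 0, 0, 0] using 1
    simp [infAct, polar_eq, Fin.sum_univ_four, Function.update_apply, e]
    ring
  · convert! h ![0, 0, 0, 1] using 1
    simp [infAct, polar_eq, Fin.sum_univ_four, Function.update_apply, e]
    ring
  · convert! h ![0, 0, 1, 1] using 1
    simp [infAct, polar_eq, Fin.sum_univ_four, Function.update_apply, e]
    ring
  · convert! h ![0, 1, 1, 1] using 1
    simp [infAct, polar_eq, Fin.sum_univ_four, Function.update_apply, e]
    ring
  · convert! h ![1, 1, 1, 1] using 1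
    simp [infAct, polar_eq, Fin.sum_univ_four, Function.update_apply, e]
    ring

theorem contDiff_act :
    ContDiff ℝ 1 fun p : (Fin 2 → Fin 2 → ℝ) × (Fin 5 → ℝ) ↦ act p.1 p.2 := by
  rw [contDiff_pi]
  intro k
  fin_cases k <;> (simp [act, polar_eq]; fun_prop)

/-- The orbit of a regular quartic is open in the level set of the absolute invariant. -/
theorem eventually_exists_act_eq {a : Fin 5 → ℝ} (ha : disc a ≠ 0) :
    ∀ᶠ b in 𝓝 a, I₀ b = I₀ a → ∃ g : Fin 2 → Fin 2 → ℝ,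
      g 0 0 * g 1 1 - g 0 1 * g 1 0 ≠ 0 ∧ b = act g a := by
  let e : Fin 2 → Fin 2 → ℝ := fun i ↦ Pi.single i 1
  -- The orbit map misses one dimension; adding the Hessian parameter makes it a submersion at `(e,
  -- 0)`.
  let Φ : (Fin 2 → Fin 2 → ℝ) × ℝ → Fin 5 → ℝ := fun p ↦ act p.1 (a + p.2 • hess a)
  have hΦ : ContDiff ℝ 1 Φ := contDiff_act.comp
    (f := fun p : (Fin 2 → Fin 2 → ℝ) × ℝ ↦ (p.1, a + p.2 • hess a)) (by fun_prop)
  have hΦ0 : Φ (e, 0) = a := by simp [Φ, e, act_one]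
  have hs := hΦ.contDiffAt.hasStrictFDerivAt (x := (e, 0)) one_ne_zero
  have hsurj : (fderiv ℝ Φ (e, 0)).range = ⊤ := by
    rw [LinearMap.range_eq_top]
    intro c
    -- By `dI₀_hess`, this `τ` puts `c - τ • hess a` in the kernel of `dI₀ a`, that is, in the image
    -- of `infAct a`.
    let τ := 3 * dI₀ a c / disc a
    let c' := c - τ • hess a
    have hc' : dI₀ a c' = 0 := by
      have h₁ : dI₀ a c' = dI₀ a c - τ * dI₀ a (hess a) := by
        simp [dI₀_eq_sum, c', Fin.sum_univ_five]
        ring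
      rw [h₁, dI₀_hess]
      simp only [τ]
      field_simp
      ring
    let γ : Fin 2 → Fin 2 → ℝ := (disc a)⁻¹ • fun i j ↦ ∑ k, infActInv a i j k * c' k
    have hγ : infAct a γ = c' := by
      rw [infAct_smul, infAct_infActInv hc', smul_smul, inv_mul_cancel₀ ha, one_smul]
    refine ⟨(γ, τ), ?_⟩
    have h₁ : HasDerivAt (fun s : ℝ ↦ Φ ((e, 0) + s • (γ, τ))) (τ • hess a + infAct a γ) 0 := by
      convert! hasDerivAt_act a (τ • hess a) γ using 1
      funext s
      simp [Φ, e, smul_smul]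
    have h₂ : HasDerivAt (fun s : ℝ ↦ Φ ((e, 0) + s • (γ, τ))) (fderiv ℝ Φ (e, 0) (γ, τ)) 0 :=
      hs.hasFDerivAt.hasLineDerivAt (γ, τ)
    change fderiv ℝ Φ (e, 0) (γ, τ) = c
    rw [h₂.unique h₁, hγ]
    simp [c']
  -- Every quartic near `a` is now `Φ (g, t)` with `(g, t)` near `(e, 0)`; invariance of `I₀` under
  -- `g` and transversality of the pencil force `t = 0`.
  have hmap := hs.map_nhds_eq_of_surj hsurj
  rw [hΦ0] at hmap
  rw [← hmap, eventually_map]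
  have hdet : ∀ᶠ p : (Fin 2 → Fin 2 → ℝ) × ℝ in 𝓝 (e, 0),
      p.1 0 0 * p.1 1 1 - p.1 0 1 * p.1 1 0 ≠ 0 := by
    refine ContinuousAt.eventually_ne (by fun_prop) ?_
    simp [e]
  have ht : ∀ᶠ p : (Fin 2 → Fin 2 → ℝ) × ℝ in 𝓝 (e, 0),
      I₀ (a + p.2 • hess a) = I₀ a → p.2 = 0 :=
    (continuous_snd.tendsto (e, (0 : ℝ))).eventually (eventually_I₀_add_smul_hess ha)
  filter_upwards [hdet, ht] with p hp ht hI
  refine ⟨p.1, hp, ?_⟩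
  have : p.2 = 0 := ht (by rwa [I₀_act hp] at hI)
  simp [Φ, this]

end BinaryQuartic

/-! ## Symmetric 4-vectors on a plane and their coefficients -/

/-- The coefficients of a binary quartic as a vector. -/
def QuarticCoeffs.vec (q : QuarticCoeffs) : Fin 5 → ℝ := ![q.a₀, q.a₁, q.a₂, q.a₃, q.a₄]

theorem QuarticCoeffs.I₀_eq (q : QuarticCoeffs) : q.I₀ = BinaryQuartic.I₀ q.vec := rfl

theorem QuarticCoeffs.discr_eq (q : QuarticCoeffs) :
    q.discr = 256 * BinaryQuartic.disc q.vec := rfl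

namespace FourTensor

variable {V : Type*} [AddCommGroup V] [Module ℝ V] [TopologicalSpace V]

/-- The standard basis vectors of the plane. -/
noncomputable abbrev stdVec (j : Fin 2) : Plane := EuclideanSpace.single j 1

/-- The coordinate covectors defined by an isomorphism with the plane. -/
noncomputable def coframe (φ : V ≃L[ℝ] Plane) (i : Fin 2) : Covector V :=
  (EuclideanSpace.proj i : Plane →L[ℝ] ℝ).comp (φ : V →L[ℝ] Plane)

theorem coframe_apply (φ : V ≃L[ℝ] Plane) (i : Fin 2) (v : V) : coframe φ i v = φ v i := rfl

theorem eq_sum_coframe [IsTopologicalAddGroup V] [ContinuousSMul ℝ V]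
    (φ : V ≃L[ℝ] Plane) (ξ : Covector V) :
    ξ = ξ (φ.symm (stdVec 0)) • coframe φ 0 + ξ (φ.symm (stdVec 1)) • coframe φ 1 := by
  ext v
  have hv : v = φ v 0 • φ.symm (stdVec 0) + φ v 1 • φ.symm (stdVec 1) := by
    apply φ.injective
    ext i
    fin_cases i <;> simp
  conv_lhs => rw [hv]
  simp [coframe_apply]
  ring

theorem sum_fin_four_fun {α β : Type*} [Fintype α] [AddCommMonoid β] (f : (Fin 4 → α) → β) :
    ∑ r, f r = ∑ i, ∑ j, ∑ k, ∑ l, f ![i, j, k, l] := by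
  simp only [← (Fin.consEquiv fun _ ↦ α).sum_comp, Fintype.sum_prod_type]
  have h : (default : Fin 0 → α) = Fin.elim0 := Subsingleton.elim _ _
  simp [Fin.consEquiv, Matrix.vecCons, Matrix.vecEmpty, h]

/-- The nondecreasing sequence of zeros and ones in which `m` entries are equal to `1`. -/
def sortedIndex (m : Fin 5) (i : Fin 4) : Fin 2 := if 4 ≤ i.val + m.val then 1 else 0

theorem exists_perm_sortedIndex (i j k l : Fin 2) : ∃ p : Equiv.Perm (Fin 4),
    ∀ n, ![i, j, k, l] n = sortedIndex ⟨i + j + k + l, by lia⟩ (p n) := by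
  revert i j k l
  decide

theorem vec_coeffs_apply (s : FourTensor V) (φ : V ≃L[ℝ] Plane) (m : Fin 5) :
    (s.coeffs φ).vec m = s fun i ↦ coframe φ (sortedIndex m i) := by
  fin_cases m <;>
  · refine congrArg s (funext fun i ↦ ?_)
    fin_cases i <;> rfl

/-- The value of a symmetric tensor is the polarization of its quartic. -/
theorem IsSymm.apply_eq_polar [IsTopologicalAddGroup V] [ContinuousSMul ℝ V]
    {s : FourTensor V} (hs : s.IsSymm) (φ : V ≃L[ℝ] Plane)
    (ξ : Fin 4 → Covector V) :
    s ξ = BinaryQuartic.polar (s.coeffs φ).vec fun i j ↦ ξ i (φ.symm (stdVec j)) := by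
  set u : Fin 4 → Fin 2 → ℝ := fun i j ↦ ξ i (φ.symm (stdVec j)) with hu
  have e : s ξ = s fun i ↦ ∑ j, u i j • coframe φ j := by
    congr 1
    funext i
    rw [Fin.sum_univ_two]
    exact eq_sum_coframe φ (ξ i)
  rw [e, MultilinearMap.map_sum]
  simp only [MultilinearMap.map_smul_univ, sum_fin_four_fun, BinaryQuartic.polar]
  refine Finset.sum_congr rfl fun i _ ↦ Finset.sum_congr rfl fun j _ ↦
    Finset.sum_congr rfl fun k _ ↦ Finset.sum_congr rfl fun l _ ↦ ?_
  -- By symmetry a component depends only on how many of its indices are `1`.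
  obtain ⟨p, hp⟩ := exists_perm_sortedIndex i j k l
  rw [vec_coeffs_apply, ← hs p fun n ↦ coframe φ (sortedIndex _ n)]
  simp only [← hp, Fin.prod_univ_four, smul_eq_mul]
  simp
  ring

theorem IsSymm.ext [IsTopologicalAddGroup V] [ContinuousSMul ℝ V]
    {s t : FourTensor V} (hs : s.IsSymm) (ht : t.IsSymm) (φ : V ≃L[ℝ] Plane)
    (h : (s.coeffs φ).vec = (t.coeffs φ).vec) : s = t := by
  ext ξ
  rw [hs.apply_eq_polar φ, ht.apply_eq_polar φ, h]

theorem IsSymm.push {W : Type*} [AddCommGroup W] [Module ℝ W] [TopologicalSpace W]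
    {s : FourTensor V} (hs : s.IsSymm) (φ : V ≃L[ℝ] W) : (s.push φ).IsSymm := by
  intro p ξ
  exact hs p fun i ↦ (ξ i).comp (φ : V →L[ℝ] W)

theorem push_trans {W X : Type*} [AddCommGroup W] [Module ℝ W] [TopologicalSpace W]
    [AddCommGroup X] [Module ℝ X] [TopologicalSpace X]
    (s : FourTensor V) (φ : V ≃L[ℝ] W) (ψ : W ≃L[ℝ] X) :
    s.push (φ.trans ψ) = (s.push φ).push ψ := rfl

theorem coeffs_push (s : FourTensor V) (φ : V ≃L[ℝ] Plane) (g : Plane ≃L[ℝ] Plane) :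
    (s.push φ).coeffs g = s.coeffs (φ.trans g) := by
  simp only [coeffs, push_apply]
  congr 2 <;> funext i <;> fin_cases i <;> rfl

theorem coeffs_push_refl (s : FourTensor V) (φ : V ≃L[ℝ] Plane) :
    (s.push φ).coeffs (.refl ℝ Plane) = s.coeffs φ :=
  coeffs_push s φ (.refl ℝ Plane)

/-- The matrix of a change of coordinates. -/
noncomputable def changeMatrix (φ ψ : V ≃L[ℝ] Plane) : Fin 2 → Fin 2 → ℝ :=
  fun i j ↦ ψ (φ.symm (stdVec j)) i

theorem apply_eq_changeMatrix (φ ψ : V ≃L[ℝ] Plane) (v : V) (i : Fin 2) :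
    ψ v i = changeMatrix φ ψ i 0 * φ v 0 + changeMatrix φ ψ i 1 * φ v 1 := by
  have hv : v = φ v 0 • φ.symm (stdVec 0) + φ v 1 • φ.symm (stdVec 1) := by
    apply φ.injective
    ext i
    fin_cases i <;> simp
  conv_lhs => rw [hv]
  simp [changeMatrix]
  ring

theorem det_changeMatrix_ne_zero (φ ψ : V ≃L[ℝ] Plane) :
    changeMatrix φ ψ 0 0 * changeMatrix φ ψ 1 1 -
      changeMatrix φ ψ 0 1 * changeMatrix φ ψ 1 0 ≠ 0 := by
  have h (i j : Fin 2) := apply_eq_changeMatrix φ ψ (ψ.symm (stdVec j)) i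
  have h₀₀ := h 0 0
  have h₀₁ := h 0 1
  have h₁₀ := h 1 0
  have h₁₁ := h 1 1
  simp at h₀₀ h₀₁ h₁₀ h₁₁
  intro hdet
  -- The two change-of-coordinate matrices are mutually inverse, so the product of their
  -- determinants is `1`.
  have : (1 : ℝ) = (changeMatrix φ ψ 0 0 * changeMatrix φ ψ 1 1 -
      changeMatrix φ ψ 0 1 * changeMatrix φ ψ 1 0) *
      (φ (ψ.symm (stdVec 0)) 0 * φ (ψ.symm (stdVec 1)) 1 -
        φ (ψ.symm (stdVec 1)) 0 * φ (ψ.symm (stdVec 0)) 1) := by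
    linear_combination h₀₀ + (changeMatrix φ ψ 0 0 * φ (ψ.symm (stdVec 0)) 0 +
      changeMatrix φ ψ 0 1 * φ (ψ.symm (stdVec 0)) 1) * h₁₁ -
      (changeMatrix φ ψ 0 0 * φ (ψ.symm (stdVec 1)) 0 +
      changeMatrix φ ψ 0 1 * φ (ψ.symm (stdVec 1)) 1) * h₁₀
  rw [hdet, zero_mul] at this
  exact one_ne_zero this

theorem IsSymm.coeffs_vec_eq_act [IsTopologicalAddGroup V] [ContinuousSMul ℝ V]
    {s : FourTensor V} (hs : s.IsSymm) (φ ψ : V ≃L[ℝ] Plane) :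
    (s.coeffs ψ).vec = BinaryQuartic.act (changeMatrix φ ψ) (s.coeffs φ).vec := by
  funext k
  fin_cases k <;>
  · refine (hs.apply_eq_polar φ _).trans ?_
    refine congrArg (BinaryQuartic.polar _) (funext fun i ↦ ?_)
    fin_cases i <;> rfl

/-- The linear automorphism of the plane with a given matrix. -/
theorem exists_equiv_of_det_ne_zero (g : Fin 2 → Fin 2 → ℝ)
    (hg : g 0 0 * g 1 1 - g 0 1 * g 1 0 ≠ 0) :
    ∃ ψ : Plane ≃L[ℝ] Plane, changeMatrix (ContinuousLinearEquiv.refl ℝ Plane) ψ = g := by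
  have hdet : IsUnit (Matrix.of g).det := by
    rw [isUnit_iff_ne_zero, Matrix.det_fin_two]
    exact hg
  let e : Plane ≃ₗ[ℝ] Plane := LinearEquiv.ofLinearMap (Matrix.toLpLin 2 2 (Matrix.of g))
    (Matrix.toLpLin 2 2 (Matrix.of g)⁻¹)
    (by rw [← Matrix.toLpLin_mul, Matrix.mul_nonsing_inv _ hdet, Matrix.toLpLin_one])
    (by rw [← Matrix.toLpLin_mul, Matrix.nonsing_inv_mul _ hdet, Matrix.toLpLin_one])
  refine ⟨e.toContinuousLinearEquiv, ?_⟩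
  funext i j
  simp [changeMatrix, e, Matrix.toLpLin_apply]

theorem IsSymm.I₀_coeffs [IsTopologicalAddGroup V] [ContinuousSMul ℝ V]
    {s : FourTensor V} (hs : s.IsSymm) (φ ψ : V ≃L[ℝ] Plane) :
    (s.coeffs ψ).I₀ = (s.coeffs φ).I₀ := by
  rw [QuarticCoeffs.I₀_eq, hs.coeffs_vec_eq_act φ ψ, BinaryQuartic.I₀_act
    (det_changeMatrix_ne_zero φ ψ), QuarticCoeffs.I₀_eq]

theorem IsRegular.disc_ne_zero {s : FourTensor V} (hs : s.IsRegular) (φ : V ≃L[ℝ] Plane) :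
    BinaryQuartic.disc (s.coeffs φ).vec ≠ 0 := by
  have := hs φ
  rw [QuarticCoeffs.discr_eq] at this
  exact right_ne_zero_of_mul this

end FourTensor

/-! ## Local frames and derivatives of functions on a surface -/

section LocalFrames

open FourTensor Topology

variable {M : Type*} [TopologicalSpace M] [ChartedSpace Plane M]

theorem MDifferentiableAt.pi_real {ι : Type*} [Fintype ι] {f : ι → M → ℝ} {x : M}
    (hf : ∀ i, MDifferentiableAt (𝓡 2) 𝓘(ℝ, ℝ) (f i) x) :
    MDifferentiableAt (𝓡 2) 𝓘(ℝ, ι → ℝ) (fun y i ↦ f i y) x := by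
  rw [mdifferentiableAt_iff]
  refine ⟨continuousAt_pi.2 fun i ↦ (hf i).continuousAt, ?_⟩
  exact differentiableWithinAt_pi.2 fun i ↦ ((mdifferentiableAt_iff _ _).1 (hf i)).2

/-- The derivative of a function of finitely many functions. -/
theorem mvfderiv_comp_pi {ι : Type*} [Fintype ι] {G : (ι → ℝ) → ℝ} {f : ι → M → ℝ} {x : M}
    (hG : DifferentiableAt ℝ G fun i ↦ f i x)
    (hf : ∀ i, MDifferentiableAt (𝓡 2) 𝓘(ℝ, ℝ) (f i) x) (X₀ : TangentSpace (𝓡 2) x) :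
    mvfderiv (𝓡 2) (fun y ↦ G fun i ↦ f i y) x X₀ =
      fderiv ℝ G (fun i ↦ f i x) fun i ↦ mvfderiv (𝓡 2) (f i) x X₀ := by
  have hF := MDifferentiableAt.pi_real hf
  have hcomp {G : (ι → ℝ) → ℝ} (hG : DifferentiableAt ℝ G fun i ↦ f i x) :
      mvfderiv (𝓡 2) (fun y ↦ G fun i ↦ f i y) x X₀ =
        fderiv ℝ G (fun i ↦ f i x) (mvfderiv (𝓡 2) (fun y i ↦ f i y) x X₀) := by
    have h := mvfderiv_comp_apply x hG.mdifferentiableAt hF X₀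
    have h' : mvfderiv 𝓘(ℝ, ι → ℝ) G (fun i ↦ f i x) = fderiv ℝ G fun i ↦ f i x := by
      rw [mvfderiv, mfderiv_eq_fderiv]
      rfl
    rw [h'] at h
    exact h
  rw [hcomp hG]
  congr 1
  funext i
  have h := hcomp (G := fun p ↦ p i) (differentiableAt_apply i _)
  rw [(hasFDerivAt_apply i _).fderiv] at h
  exact h.symm

variable [IsManifold (𝓡 2) ∞ M]

/-- The derivative of a smooth function along a smooth vector field is smooth. -/
theorem ContMDiffAt.mvfderiv_apply {f : M → ℝ} {x : M}
    (hf : ContMDiffAt (𝓡 2) 𝓘(ℝ, ℝ) ∞ f x) {Y : VectFld M}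
    (hY : ContMDiffAt (𝓡 2) ((𝓡 2).prod 𝓘(ℝ, Plane)) ∞
      (fun y ↦ TotalSpace.mk' Plane (E := fun y : M ↦ TangentSpace (𝓡 2) y) y (Y y)) x) :
    ContMDiffAt (𝓡 2) 𝓘(ℝ, ℝ) ∞ (fun y ↦ mvfderiv (𝓡 2) f y (Y y)) x := by
  have h₁ := hf.mfderiv_const (m := ∞) (by simp)
  have h₂ := (h₁.clm_apply ((contMDiffAt_totalSpace.1 hY).2))
  apply h₂.congr_of_eventuallyEq
  filter_upwards [(Trivialization.open_baseSet _).mem_nhds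
    (FiberBundle.mem_baseSet_trivializationAt Plane (fun x : M ↦ TangentSpace (𝓡 2) x) x)] with b hb
  have h₃ : (trivializationAt Plane (TangentSpace (𝓡 2)) x).symmL ℝ b
      (trivializationAt Plane (TangentSpace (𝓡 2)) x ⟨b, Y b⟩).2 = Y b := by
    rw [Trivialization.symmL_apply _ hb, Trivialization.symm_apply_apply_mk _ hb]
  change _ = ContinuousLinearMap.inCoordinates Plane (TangentSpace (𝓡 2)) ℝ
    (TangentSpace 𝓘(ℝ, ℝ)) x b (f x) (f b) (mfderiv (𝓡 2) 𝓘(ℝ, ℝ) f b)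
      (trivializationAt Plane (TangentSpace (𝓡 2)) x ⟨b, Y b⟩).2
  rw [ContinuousLinearMap.inCoordinates, TangentBundle.continuousLinearMapAt_model_space]
  exact (congrArg (mvfderiv (𝓡 2) f b) h₃).symm

/-! ### Frames and coframes given by the trivializations of the tangent bundle -/

variable (x₀ : M)

/-- The domain of the local frame centred at a point. -/
abbrev frameDomain : Set M := (trivializationAt Plane (fun x : M ↦ TangentSpace (𝓡 2) x) x₀).baseSet

theorem isOpen_frameDomain : IsOpen (frameDomain x₀) := Trivialization.open_baseSet _

theorem mem_frameDomain : x₀ ∈ frameDomain x₀ :=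
  FiberBundle.mem_baseSet_trivializationAt Plane (fun x : M ↦ TangentSpace (𝓡 2) x) x₀

/-- The trivialization of the tangent bundle centred at `x₀`. -/
noncomputable def frameEquiv (y : M) (hy : y ∈ frameDomain x₀) :
    TangentSpace (𝓡 2) y ≃L[ℝ] Plane :=
  (trivializationAt Plane (fun x : M ↦ TangentSpace (𝓡 2) x) x₀).continuousLinearEquivAt ℝ y hy

/-- The local frame centred at `x₀`. -/
noncomputable def frame (j : Fin 2) : VectFld M := fun y ↦
  (trivializationAt Plane (fun x : M ↦ TangentSpace (𝓡 2) x) x₀).symmL ℝ y (stdVec j)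

/-- The local coframe centred at `x₀`. -/
noncomputable def frameDual (i : Fin 2) : OneForm M := fun y ↦
  (EuclideanSpace.proj i : Plane →L[ℝ] ℝ).comp
    ((trivializationAt Plane (fun x : M ↦ TangentSpace (𝓡 2) x) x₀).continuousLinearMapAt ℝ y)

variable {x₀} {y : M}

theorem frameDual_eq (hy : y ∈ frameDomain x₀) (i : Fin 2) :
    frameDual x₀ i y = coframe (frameEquiv x₀ y hy) i := by
  rw [coframe, frameEquiv, Trivialization.coe_continuousLinearEquivAt_eq']
  rfl

theorem frame_eq (hy : y ∈ frameDomain x₀) (j : Fin 2) :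
    frame x₀ j y = (frameEquiv x₀ y hy).symm (stdVec j) := by
  rw [frame, frameEquiv, Trivialization.symm_continuousLinearEquivAt_eq]

theorem frameDual_frame (hy : y ∈ frameDomain x₀) (i j : Fin 2) :
    frameDual x₀ i y (frame x₀ j y) = if i = j then 1 else 0 := by
  rw [frameDual_eq hy, frame_eq hy, coframe_apply]
  simp

theorem eq_sum_frame (hy : y ∈ frameDomain x₀) (v : TangentSpace (𝓡 2) y) :
    v = ∑ i, frameDual x₀ i y v • frame x₀ i y := by
  apply (frameEquiv x₀ y hy).injective
  ext k
  simp only [frameDual_eq hy, frame_eq hy, coframe_apply, Fin.sum_univ_two]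
  fin_cases k <;> simp

theorem contMDiffAt_frame (hy : y ∈ frameDomain x₀) (j : Fin 2) :
    ContMDiffAt (𝓡 2) ((𝓡 2).prod 𝓘(ℝ, Plane)) ∞
      (fun y ↦ TotalSpace.mk' Plane (E := fun y : M ↦ TangentSpace (𝓡 2) y) y (frame x₀ j y)) y :=
  ((trivializationAt Plane (fun x : M ↦ TangentSpace (𝓡 2) x) x₀).contMDiffAt_symmL
    hy).clm_bundle_apply (E₁ := Bundle.Trivial M Plane) (b := fun y ↦ y)
    (v := fun _ ↦ stdVec j) (contMDiffAt_section _ |>.2 contMDiffAt_const)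

theorem frame_diffAt (hy : y ∈ frameDomain x₀) (j : Fin 2) : (frame x₀ j).DiffAt y :=
  (contMDiffAt_frame hy j).mdifferentiableAt (by simp)

theorem frameDual_smoothAt (hy : y ∈ frameDomain x₀) (i : Fin 2) :
    (frameDual x₀ i).SmoothAt y := by
  let e := trivializationAt Plane (fun x : M ↦ TangentSpace (𝓡 2) x) x₀
  have hy' := mem_frameDomain y
  refine contMDiffAt_totalSpace.mpr ⟨contMDiffAt_id, ?_⟩
  -- Read in the trivialization centred at `y`, the covector is a fixed coordinate projection
  -- composed with the smooth change of trivialization.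
  have h₁ := contMDiffAt_coordChangeL (n := ∞) (IB := 𝓡 2) (e := trivializationAt Plane
    (fun x : M ↦ TangentSpace (𝓡 2) x) y) (e' := e) hy' hy
  have h₂ : ContMDiffAt (𝓡 2) 𝓘(ℝ, Plane →L[ℝ] ℝ) ∞
    (fun b ↦ (EuclideanSpace.proj i : Plane →L[ℝ] ℝ).comp
      (Trivialization.coordChangeL ℝ (trivializationAt Plane
        (fun x : M ↦ TangentSpace (𝓡 2) x) y) e b : Plane →L[ℝ] Plane)) y :=
    contMDiffAt_const.clm_comp h₁
  apply h₂.congr_of_eventuallyEq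
  filter_upwards [(isOpen_frameDomain x₀).mem_nhds hy, (isOpen_frameDomain y).mem_nhds hy']
    with b hb hb'
  ext v
  simp [hom_trivializationAt_apply, ContinuousLinearMap.inCoordinates, frameDual,
    Trivialization.coordChangeL_apply' _ e ⟨hb', hb⟩, Trivialization.symmL_apply _ hb',
    Trivialization.coe_linearMapAt_of_mem _ hb, Trivialization.mk_symm _ hb', e]

theorem frameDual_diffAt (hy : y ∈ frameDomain x₀) (i : Fin 2) : (frameDual x₀ i).DiffAt y :=
  (frameDual_smoothAt hy i).mdifferentiableAt (by simp)

variable (x₀) in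
/-- The coefficients of a symmetric 4-vector in the local frame centred at `x₀`. -/
noncomputable def SymmFourVector.comp (σ : SymmFourVector M) (k : Fin 5) : M → ℝ :=
  fun y ↦ σ.toFun y fun i ↦ frameDual x₀ (sortedIndex k i) y

theorem SymmFourVector.comp_eq (σ : SymmFourVector M) (hy : y ∈ frameDomain x₀) :
    (fun k ↦ σ.comp x₀ k y) = ((σ.toFun y).coeffs (frameEquiv x₀ y hy)).vec := by
  funext k
  rw [vec_coeffs_apply]
  simp only [comp, frameDual_eq hy]

theorem SymmFourVector.contMDiffAt_comp (σ : SymmFourVector M) (hy : y ∈ frameDomain x₀)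
    (k : Fin 5) : ContMDiffAt (𝓡 2) 𝓘(ℝ, ℝ) ∞ (σ.comp x₀ k) y :=
  σ.smooth y _ fun _ ↦ frameDual_smoothAt hy _

theorem SymmFourVector.mdifferentiableAt_comp (σ : SymmFourVector M) (hy : y ∈ frameDomain x₀)
    (k : Fin 5) : MDifferentiableAt (𝓡 2) 𝓘(ℝ, ℝ) (σ.comp x₀ k) y :=
  (σ.contMDiffAt_comp hy k).mdifferentiableAt (by simp)

theorem SymmFourVector.apply_eq_polar (σ : SymmFourVector M) (hy : y ∈ frameDomain x₀)
    (ξ : Fin 4 → Covector (TangentSpace (𝓡 2) y)) :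
    σ.toFun y ξ = BinaryQuartic.polar (fun k ↦ σ.comp x₀ k y) fun i j ↦ ξ i (frame x₀ j y) := by
  rw [(σ.symm y).apply_eq_polar (frameEquiv x₀ y hy), σ.comp_eq hy]
  simp only [frame_eq hy]

end LocalFrames

/-! ## Parallelism in terms of connection coefficients -/

namespace BinaryQuartic

open FourTensor

theorem polar_add (a b : Fin 5 → ℝ) (u : Fin 4 → Fin 2 → ℝ) :
    polar (a + b) u = polar a u + polar b u := by
  simp only [polar, Pi.add_apply, add_mul, Finset.sum_add_distrib]

theorem polar_update_sub (a : Fin 5 → ℝ) (u : Fin 4 → Fin 2 → ℝ) (i : Fin 4)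
    (w w' : Fin 2 → ℝ) : polar a (Function.update u i (w - w')) =
      polar a (Function.update u i w) - polar a (Function.update u i w') := by
  fin_cases i <;> (simp [polar_eq]; ring)

theorem polar_sortedIndex (c : Fin 5 → ℝ) (k : Fin 5) :
    polar c (fun i j ↦ if sortedIndex k i = j then 1 else 0) = c k := by
  fin_cases k <;> simp [polar_eq, sortedIndex]

theorem polar_zero (u : Fin 4 → Fin 2 → ℝ) : polar 0 u = 0 := by
  simp [polar]

/-- The polarization as a function of all its variables. -/
def polarFun (p : Fin 5 ⊕ Fin 4 × Fin 2 → ℝ) : ℝ :=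
  polar (fun k ↦ p (.inl k)) fun i j ↦ p (.inr (i, j))

theorem differentiable_polarFun : Differentiable ℝ polarFun := by
  unfold polarFun polar
  fun_prop

theorem fderiv_polarFun (p v : Fin 5 ⊕ Fin 4 × Fin 2 → ℝ) :
    fderiv ℝ polarFun p v = polar (fun k ↦ v (.inl k)) (fun i j ↦ p (.inr (i, j))) +
      ∑ i, polar (fun k ↦ p (.inl k))
        (Function.update (fun i j ↦ p (.inr (i, j))) i fun j ↦ v (.inr (i, j))) :=
  ((differentiable_polarFun p).hasFDerivAt.hasLineDerivAt v).unique (hasDerivAt_polar _ _ _ _)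

/-! ### Differentials of the invariants -/

theorem hasDerivAt_I₂ (a c : Fin 5 → ℝ) :
    HasDerivAt (fun t : ℝ ↦ I₂ (a + t • c)) (dI₂ a c) 0 := by
  have h : HasDerivAt (fun t : ℝ ↦ I₂ a + t * dI₂ a c + t ^ 2 * I₂ c) (dI₂ a c) 0 := by
    simpa using (((hasDerivAt_id (0 : ℝ)).mul_const (dI₂ a c)).const_add (I₂ a)).fun_add
      ((hasDerivAt_pow 2 (0 : ℝ)).mul_const (I₂ c))
  convert! h using 1
  funext t
  simp [I₂, dI₂]
  ring

theorem differentiable_I₂ : Differentiable ℝ I₂ := by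
  unfold I₂
  fun_prop

theorem fderiv_I₂ (a c : Fin 5 → ℝ) : fderiv ℝ I₂ a c = dI₂ a c :=
  ((differentiable_I₂ a).hasFDerivAt.hasLineDerivAt c).unique (hasDerivAt_I₂ a c)

theorem hasDerivAt_I₃ (a c : Fin 5 → ℝ) :
    HasDerivAt (fun t : ℝ ↦ I₃ (a + t • c)) (dI₃ a c) 0 := by
  have h : HasDerivAt (fun t : ℝ ↦ I₃ a + t * dI₃ a c + t ^ 2 * dI₃ c a + t ^ 3 * I₃ c)
      (dI₃ a c) 0 := by
    simpa using ((((hasDerivAt_id (0 : ℝ)).mul_const (dI₃ a c)).const_add (I₃ a)).fun_add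
      ((hasDerivAt_pow 2 (0 : ℝ)).mul_const (dI₃ c a))).fun_add
      ((hasDerivAt_pow 3 (0 : ℝ)).mul_const (I₃ c))
  convert! h using 1
  funext t
  simp [I₃, dI₃]
  ring

theorem differentiable_I₃ : Differentiable ℝ I₃ := by
  unfold I₃
  fun_prop

theorem fderiv_I₃ (a c : Fin 5 → ℝ) : fderiv ℝ I₃ a c = dI₃ a c :=
  ((differentiable_I₃ a).hasFDerivAt.hasLineDerivAt c).unique (hasDerivAt_I₃ a c)

theorem differentiableAt_J {a : Fin 5 → ℝ} (ha : disc a ≠ 0) : DifferentiableAt ℝ J a := by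
  have h₂ := differentiable_I₂ a
  have h₃ := differentiable_I₃ a
  have h : J = fun a ↦ I₂ a ^ 3 * (I₂ a ^ 3 - 27 * I₃ a ^ 2)⁻¹ := by
    funext a
    exact div_eq_mul_inv _ _
  rw [h]
  exact (h₂.fun_pow 3).fun_mul
    (((h₂.fun_pow 3).fun_sub ((h₃.fun_pow 2).const_mul 27)).fun_inv ha)

/-- The absolute invariant is constant along the orbits. -/
theorem fderiv_J_infAct {a : Fin 5 → ℝ} (ha : disc a ≠ 0) (γ : Fin 2 → Fin 2 → ℝ) :
    fderiv ℝ J a (infAct a γ) = 0 := by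
  refine ((differentiableAt_J ha).hasFDerivAt.hasLineDerivAt _).unique ?_
  have h₂ := hasDerivAt_I₂ a (infAct a γ)
  have h₃ := hasDerivAt_I₃ a (infAct a γ)
  have h := (h₂.fun_pow 3).fun_div ((h₂.fun_pow 3).fun_sub ((h₃.fun_pow 2).const_mul 27))
    (by simpa [disc] using ha)
  refine h.congr_deriv ?_
  rw [div_eq_zero_iff]
  left
  simp [dI₂_infAct, dI₃_infAct]
  ring

end BinaryQuartic

section Parallel

open FourTensor Topology

variable {M : Type*} [TopologicalSpace M] [ChartedSpace Plane M]

theorem Filter.EventuallyEq.mvfderiv_eq {f g : M → ℝ} {x : M} (h : f =ᶠ[𝓝 x] g) :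
    mvfderiv (𝓡 2) f x = mvfderiv (𝓡 2) g x := by
  rw [mvfderiv, mvfderiv, h.mfderiv_eq]
  rfl

variable [IsManifold (𝓡 2) ∞ M] {x₀ y : M}

namespace TangentConnection

/-- The coefficients of a connection in the local frame centred at `x₀`. -/
noncomputable def christoffel (cov : TangentConnection M) (x₀ : M) {y : M}
    (X₀ : TangentSpace (𝓡 2) y) : Fin 2 → Fin 2 → ℝ :=
  fun i j ↦ frameDual x₀ i y (cov (frame x₀ j) y X₀)

theorem dual_frame (cov : TangentConnection M) (hy : y ∈ frameDomain x₀) {ξ : OneForm M}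
    (hξ : ξ.DiffAt y) (X₀ : TangentSpace (𝓡 2) y) (j : Fin 2) :
    cov.dual hξ X₀ (frame x₀ j y) = mvfderiv (𝓡 2) (fun z ↦ ξ z (frame x₀ j z)) y X₀ -
      (ξ y (frame x₀ 0 y) * cov.christoffel x₀ X₀ 0 j +
        ξ y (frame x₀ 1 y) * cov.christoffel x₀ X₀ 1 j) := by
  rw [cov.dual_apply hξ X₀ (frame_diffAt hy j)]
  congr 1
  conv_lhs => rw [eq_sum_frame hy (cov (frame x₀ j) y X₀)]
  simp [Fin.sum_univ_two, christoffel, mul_comm]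

/-- Pairing with the coframe, whose dual derivative has components `-Γ`, gives the coordinate
formula for `∇Y` without expanding `Y` in the frame near `y`. -/
theorem frameDual_apply_cov (cov : TangentConnection M) (hy : y ∈ frameDomain x₀)
    {Y : VectFld M} (hY : Y.DiffAt y) (X₀ : TangentSpace (𝓡 2) y) (i : Fin 2) :
    frameDual x₀ i y (cov Y y X₀) = mvfderiv (𝓡 2) (fun z ↦ frameDual x₀ i z (Y z)) y X₀ +
      ∑ j, cov.christoffel x₀ X₀ i j * frameDual x₀ j y (Y y) := by
  have hi := frameDual_diffAt hy i
  have h₁ := cov.dual_apply hi X₀ hY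
  have h₂ (j : Fin 2) : cov.dual hi X₀ (frame x₀ j y) = -cov.christoffel x₀ X₀ i j := by
    have h₃ : (fun z ↦ frameDual x₀ i z (frame x₀ j z)) =ᶠ[𝓝 y]
        fun _ ↦ if i = j then (1 : ℝ) else 0 := by
      filter_upwards [(isOpen_frameDomain x₀).mem_nhds hy] with z hz
      exact frameDual_frame hz i j
    rw [cov.dual_frame hy hi, h₃.mvfderiv_eq, mvfderiv_const]
    simp only [frameDual_frame hy]
    fin_cases i <;> simp
  rw [eq_sum_frame hy (Y y)] at h₁
  simp only [map_sum, map_smul, h₂, smul_eq_mul] at h₁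
  rw [Fin.sum_univ_two] at h₁ ⊢
  linear_combination h₁

/-- The covariant derivative of a symmetric 4-vector in a local frame. -/
theorem derivFourVector_eq_polar (cov : TangentConnection M) (σ : SymmFourVector M)
    (hy : y ∈ frameDomain x₀) (X₀ : TangentSpace (𝓡 2) y) {ξ : Fin 4 → OneForm M}
    (hξ : ∀ i, (ξ i).DiffAt y) :
    cov.derivFourVector σ X₀ hξ = BinaryQuartic.polar
      ((fun k ↦ mvfderiv (𝓡 2) (σ.comp x₀ k) y X₀) +
        BinaryQuartic.infAct (fun k ↦ σ.comp x₀ k y) (cov.christoffel x₀ X₀))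
      fun i j ↦ ξ i y (frame x₀ j y) := by
  let f : Fin 5 ⊕ Fin 4 × Fin 2 → M → ℝ :=
    Sum.elim (fun k ↦ σ.comp x₀ k) fun p z ↦ ξ p.1 z (frame x₀ p.2 z)
  have hf (q) : MDifferentiableAt (𝓡 2) 𝓘(ℝ, ℝ) (f q) y := by
    rcases q with k | p
    · exact σ.mdifferentiableAt_comp hy k
    · exact (hξ p.1).apply_vectorField (frame_diffAt hy p.2)
  have h₁ : (fun z ↦ σ.toFun z fun i ↦ ξ i z) =ᶠ[𝓝 y]
      fun z ↦ BinaryQuartic.polarFun fun q ↦ f q z := by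
    filter_upwards [(isOpen_frameDomain x₀).mem_nhds hy] with z hz
    rw [σ.apply_eq_polar hz]
    rfl
  have h₂ (i : Fin 4) : σ.toFun y (Function.update (fun j ↦ ξ j y) i (cov.dual (hξ i) X₀)) =
      BinaryQuartic.polar (fun k ↦ σ.comp x₀ k y)
        (Function.update (fun i j ↦ ξ i y (frame x₀ j y)) i
          ((fun j ↦ mvfderiv (𝓡 2) (fun z ↦ ξ i z (frame x₀ j z)) y X₀) -
            fun j ↦ ξ i y (frame x₀ 0 y) * cov.christoffel x₀ X₀ 0 j +
              ξ i y (frame x₀ 1 y) * cov.christoffel x₀ X₀ 1 j)) := by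
    rw [σ.apply_eq_polar hy]
    congr 1
    funext m j
    by_cases hm : m = i
    · subst hm
      simp [cov.dual_frame hy]
    · simp [hm]
  -- The derivatives of the components of the `ξ i` occur both in the product rule and in the dual
  -- connection, and cancel. The connection coefficients that remain assemble into `infAct` by
  -- `sum_polar_update`.
  rw [derivFourVector, h₁.mvfderiv_eq,
    mvfderiv_comp_pi (BinaryQuartic.differentiable_polarFun _) hf,
    BinaryQuartic.fderiv_polarFun, BinaryQuartic.polar_add, ← BinaryQuartic.sum_polar_update]
  simp only [h₂, BinaryQuartic.polar_update_sub, Finset.sum_sub_distrib, f, Sum.elim_inl,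
    Sum.elim_inr]
  ring

/-- Testing on the coframe reads off each coefficient of the quartic in `derivFourVector_eq_polar`,
so its polarization vanishes only if the quartic does. -/
theorem parallel_iff (cov : TangentConnection M) (σ : SymmFourVector M)
    (hy : y ∈ frameDomain x₀) (X₀ : TangentSpace (𝓡 2) y) :
    (∀ (ξ : Fin 4 → OneForm M) (hξ : ∀ i, (ξ i).DiffAt y), cov.derivFourVector σ X₀ hξ = 0) ↔
      (fun k ↦ mvfderiv (𝓡 2) (σ.comp x₀ k) y X₀) +
        BinaryQuartic.infAct (fun k ↦ σ.comp x₀ k y) (cov.christoffel x₀ X₀) = 0 := by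
  constructor
  · intro h
    funext k
    have := h (fun i ↦ frameDual x₀ (sortedIndex k i)) fun _ ↦ frameDual_diffAt hy _
    rw [cov.derivFourVector_eq_polar σ hy] at this
    simp only [frameDual_frame hy] at this
    rwa [BinaryQuartic.polar_sortedIndex] at this
  · intro h ξ hξ
    rw [cov.derivFourVector_eq_polar σ hy, h, BinaryQuartic.polar_zero]

end TangentConnection

theorem SymmFourVector.IsRegular.disc_comp_ne_zero {σ : SymmFourVector M} (hσ : σ.IsRegular)
    (hy : y ∈ frameDomain x₀) : BinaryQuartic.disc (fun k ↦ σ.comp x₀ k y) ≠ 0 := by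
  rw [σ.comp_eq hy]
  exact (hσ y).disc_ne_zero _

/-- The left inverse of the infinitesimal action solves the parallelism equation. The right-hand
side involves only `σ`, which yields both uniqueness and smoothness. -/
theorem TangentConnection.christoffel_eq_of_parallel {cov : TangentConnection M}
    {σ : SymmFourVector M} (hσ : σ.IsRegular)
    (hcov : ∀ (ξ : Fin 4 → OneForm M) (X₀ : TangentSpace (𝓡 2) y) (hξ : ∀ i, (ξ i).DiffAt y),
      cov.derivFourVector σ X₀ hξ = 0)
    (hy : y ∈ frameDomain x₀) (X₀ : TangentSpace (𝓡 2) y) (i j : Fin 2) :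
    cov.christoffel x₀ X₀ i j = -(BinaryQuartic.disc fun k ↦ σ.comp x₀ k y)⁻¹ *
      ∑ k, BinaryQuartic.infActInv (fun k ↦ σ.comp x₀ k y) i j k *
        mvfderiv (𝓡 2) (σ.comp x₀ k) y X₀ := by
  have h := (cov.parallel_iff σ hy X₀).1 fun ξ hξ ↦ hcov ξ X₀ hξ
  have h' (k : Fin 5) : mvfderiv (𝓡 2) (σ.comp x₀ k) y X₀ =
      -BinaryQuartic.infAct (fun k ↦ σ.comp x₀ k y) (cov.christoffel x₀ X₀) k :=
    eq_neg_of_add_eq_zero_left (congrFun h k)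
  simp only [h', mul_neg, Finset.sum_neg_distrib, BinaryQuartic.infActInv_infAct]
  have := hσ.disc_comp_ne_zero hy
  field_simp

end Parallel

/-! ## Constant type and the absolute invariant -/

section ConstantType

open FourTensor Topology

variable {M : Type*} [TopologicalSpace M] [ChartedSpace Plane M]

theorem mdifferentiableAt_comp_pi {ι : Type*} [Fintype ι] {G : (ι → ℝ) → ℝ} {f : ι → M → ℝ}
    {x : M} (hG : DifferentiableAt ℝ G fun i ↦ f i x)
    (hf : ∀ i, MDifferentiableAt (𝓡 2) 𝓘(ℝ, ℝ) (f i) x) :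
    MDifferentiableAt (𝓡 2) 𝓘(ℝ, ℝ) (fun y ↦ G fun i ↦ f i y) x := by
  exact hG.mdifferentiableAt.comp x (MDifferentiableAt.pi_real hf)

variable [IsManifold (𝓡 2) ∞ M]

/-- A function with zero derivative is locally constant. -/
theorem eventually_eq_of_mvfderiv_eq_zero {f : M → ℝ}
    (hf : MDifferentiable (𝓡 2) 𝓘(ℝ, ℝ) f) (hf' : ∀ x, mvfderiv (𝓡 2) f x = 0) (x : M) :
    ∀ᶠ y in 𝓝 x, f y = f x := by
  set φ := extChartAt (𝓡 2) x
  obtain ⟨r, hr, hball⟩ := Metric.isOpen_iff.1 (isOpen_extChartAt_target (I := 𝓡 2) x) (φ x)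
    (mem_extChartAt_target x)
  have hd : ∀ z ∈ Metric.ball (φ x) r, HasFDerivAt (f ∘ φ.symm) (0 : Plane →L[ℝ] ℝ) z := by
    intro z hz
    have h₁ : MDifferentiableAt 𝓘(ℝ, Plane) (𝓡 2) φ.symm z :=
      ((contMDiffOn_extChartAt_symm (n := ∞) x).contMDiffAt
        ((isOpen_extChartAt_target x).mem_nhds (hball hz))).mdifferentiableAt (by simp)
    have h₂ := (hf (φ.symm z)).hasMFDerivAt.comp z h₁.hasMFDerivAt
    have h₃ : (mfderiv (𝓡 2) 𝓘(ℝ, ℝ) f (φ.symm z)).comp (mfderiv 𝓘(ℝ, Plane) (𝓡 2) φ.symm z) =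
        (0 : Plane →L[ℝ] ℝ) :=
      ContinuousLinearMap.ext fun v ↦
        congrArg (fun A ↦ A (mfderiv 𝓘(ℝ, Plane) (𝓡 2) φ.symm z v)) (hf' (φ.symm z))
    rw [h₃] at h₂
    exact h₂.hasFDerivAt
  have hc : ∀ z ∈ Metric.ball (φ x) r, (f ∘ φ.symm) z = (f ∘ φ.symm) (φ x) := fun z hz ↦
    Metric.isOpen_ball.is_const_of_fderiv_eq_zero (𝕜 := ℝ) (convex_ball _ _).isPreconnected
      (fun z hz ↦ (hd z hz).differentiableAt.differentiableWithinAt)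
      (fun z hz ↦ (hd z hz).fderiv) hz (Metric.mem_ball_self hr)
  filter_upwards [(continuousAt_extChartAt (I := 𝓡 2) x).eventually (Metric.ball_mem_nhds _ hr),
    extChartAt_source_mem_nhds (I := 𝓡 2) x] with y hy hy'
  have h : f (φ.symm (φ y)) = f (φ.symm (φ x)) := hc _ hy
  rwa [φ.left_inv hy', φ.left_inv (mem_extChartAt_source x)] at h

namespace SymmFourVector

variable {σ : SymmFourVector M}

/-- The finite absolute invariant of a regular symmetric 4-vector. -/
noncomputable def invariantJ (σ : SymmFourVector M) (y : M) : ℝ :=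
  BinaryQuartic.J fun k ↦ σ.comp y k y

theorem invariantJ_eq (hσ : σ.IsRegular) {y : M} (φ : TangentSpace (𝓡 2) y ≃L[ℝ] Plane) :
    σ.invariantJ y = BinaryQuartic.J ((σ.toFun y).coeffs φ).vec := by
  rw [invariantJ, σ.comp_eq (mem_frameDomain y), ← BinaryQuartic.I₀_eq_iff_J_eq
    ((hσ y).disc_ne_zero _) ((hσ y).disc_ne_zero _)]
  exact (σ.symm y).I₀_coeffs φ _

/-- Parallelism makes the derivatives of the coefficients tangent to orbits, along which `J` is
stationary. Using `J` avoids differentiating `I₀` where it is infinite. -/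
theorem hasConstantI₀_of_isWagner [PreconnectedSpace M] [Nonempty M] (hσ : σ.IsRegular)
    {cov : TangentConnection M} (hcov : cov.IsWagner σ) : σ.HasConstantI₀ := by
  have key (x : M) : MDifferentiableAt (𝓡 2) 𝓘(ℝ, ℝ) σ.invariantJ x ∧
      mvfderiv (𝓡 2) σ.invariantJ x = 0 := by
    -- The definition uses a different frame at every point; invariance replaces it by one frame
    -- near `x`.
    have h₁ : σ.invariantJ =ᶠ[𝓝 x] fun y ↦ BinaryQuartic.J fun k ↦ σ.comp x k y := by
      filter_upwards [(isOpen_frameDomain x).mem_nhds (mem_frameDomain x)] with y hy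
      rw [invariantJ_eq hσ (frameEquiv x y hy), σ.comp_eq hy]
    have hdisc := hσ.disc_comp_ne_zero (mem_frameDomain x)
    have hJ := BinaryQuartic.differentiableAt_J hdisc
    have hc := σ.mdifferentiableAt_comp (mem_frameDomain x)
    refine ⟨(mdifferentiableAt_comp_pi hJ hc).congr_of_eventuallyEq h₁, ?_⟩
    ext X₀
    rw [h₁.mvfderiv_eq, mvfderiv_comp_pi hJ hc, eq_neg_of_add_eq_zero_left
      ((cov.parallel_iff σ (mem_frameDomain x) X₀).1 (hcov.parallel x X₀)), map_neg,
      BinaryQuartic.fderiv_J_infAct hdisc]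
    simp
  have hconst : IsLocallyConstant σ.invariantJ := (IsLocallyConstant.iff_eventually_eq _).2
    fun x ↦ eventually_eq_of_mvfderiv_eq_zero (fun x ↦ (key x).1) (fun x ↦ (key x).2) x
  obtain ⟨x₁⟩ := ‹Nonempty M›
  refine ⟨((σ.toFun x₁).coeffs (frameEquiv x₁ x₁ (mem_frameDomain x₁))).I₀, fun x φ ↦ ?_⟩
  rw [QuarticCoeffs.I₀_eq, QuarticCoeffs.I₀_eq, BinaryQuartic.I₀_eq_iff_J_eq
    ((hσ x).disc_ne_zero _) ((hσ x₁).disc_ne_zero _), ← invariantJ_eq hσ, ← invariantJ_eq hσ]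
  exact hconst.apply_eq_of_preconnectedSpace x x₁

theorem HasConstantType.hasConstantI₀ (h : σ.HasConstantType) : σ.HasConstantI₀ := by
  obtain ⟨w, ⟨s, hs, -, rfl⟩, hw⟩ := h
  refine ⟨(s.coeffs (.refl ℝ Plane)).I₀, fun x φ ↦ ?_⟩
  obtain ⟨g, hg⟩ := hw x φ
  rw [← coeffs_push_refl, ← hg, coeffs_push_refl, hs.I₀_coeffs (.refl ℝ Plane)]

/-- The symbols at two points are equivalent. -/
def Equivalent (σ : SymmFourVector M) (x y : M) : Prop :=
  ∃ (φ : TangentSpace (𝓡 2) x ≃L[ℝ] Plane) (ψ : TangentSpace (𝓡 2) y ≃L[ℝ] Plane),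
    (σ.toFun x).push φ = (σ.toFun y).push ψ

theorem Equivalent.symm {x y : M} (h : σ.Equivalent x y) : σ.Equivalent y x := by
  obtain ⟨φ, ψ, h⟩ := h
  exact ⟨ψ, φ, h.symm⟩

theorem push_eq_push_of_push_eq_push {x y : M} {φ : TangentSpace (𝓡 2) x ≃L[ℝ] Plane}
    {ψ : TangentSpace (𝓡 2) y ≃L[ℝ] Plane}
    (h : (σ.toFun x).push φ = (σ.toFun y).push ψ) (χ : TangentSpace (𝓡 2) y ≃L[ℝ] Plane) :
    (σ.toFun x).push (φ.trans (ψ.symm.trans χ)) = (σ.toFun y).push χ := by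
  rw [push_trans, h, ← push_trans]
  congr 1
  ext v
  simp

theorem Equivalent.trans {x y z : M} (h : σ.Equivalent x y) (h' : σ.Equivalent y z) :
    σ.Equivalent x z := by
  obtain ⟨φ, ψ, h⟩ := h
  obtain ⟨χ, θ, h'⟩ := h'
  exact ⟨_, θ, (push_eq_push_of_push_eq_push h χ).trans h'⟩

/-- The coefficients in one frame vary continuously and stay in a level set of `I₀`, where the orbit
of the quartic at `x` is open. -/
theorem eventually_equivalent (hσ : σ.IsRegular) (h : σ.HasConstantI₀) (x : M) :
    ∀ᶠ y in 𝓝 x, σ.Equivalent x y := by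
  obtain ⟨c, hc⟩ := h
  have hcont : ContinuousAt (fun y k ↦ σ.comp x k y) x :=
    continuousAt_pi.2 fun k ↦ (σ.mdifferentiableAt_comp (mem_frameDomain x) k).continuousAt
  filter_upwards [hcont.eventually (BinaryQuartic.eventually_exists_act_eq
    (hσ.disc_comp_ne_zero (mem_frameDomain x))),
    (isOpen_frameDomain x).mem_nhds (mem_frameDomain x)] with y hy hyx
  rw [σ.comp_eq hyx, σ.comp_eq (mem_frameDomain x)] at hy
  obtain ⟨g, hg, hgy⟩ := hy ((hc y _).trans (hc x _).symm)
  obtain ⟨ψ, rfl⟩ := exists_equiv_of_det_ne_zero g hg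
  refine ⟨(frameEquiv x x (mem_frameDomain x)).trans ψ, frameEquiv x y hyx, ?_⟩
  refine ((σ.symm x).push _).ext ((σ.symm y).push _) (.refl ℝ Plane) ?_
  rw [push_trans, coeffs_push_refl, coeffs_push_refl]
  have h₁ := ((σ.symm x).push (frameEquiv x x (mem_frameDomain x))).coeffs_vec_eq_act
    (.refl ℝ Plane) ψ
  rw [coeffs_push_refl] at h₁
  exact h₁.trans hgy.symm

/-- Equivalence of symbols is an equivalence relation with open classes, so a connected surface has
only one class. -/
theorem HasConstantI₀.hasConstantType [PreconnectedSpace M] [Nonempty M] (hσ : σ.IsRegular)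
    (h : σ.HasConstantI₀) : σ.HasConstantType := by
  obtain ⟨x₁⟩ := ‹Nonempty M›
  let φ₁ := frameEquiv x₁ x₁ (mem_frameDomain x₁)
  have hall (x : M) : σ.Equivalent x₁ x := by
    have : Std.Symm σ.Equivalent := ⟨fun _ _ ↦ Equivalent.symm⟩
    exact PreconnectedSpace.induction₂ σ.Equivalent (eventually_equivalent hσ h)
      ⟨fun _ _ _ ↦ Equivalent.trans⟩ x₁ x
  refine ⟨_, ⟨(σ.toFun x₁).push φ₁, (σ.symm x₁).push _, fun g ↦ ?_, rfl⟩, fun x φ ↦ ?_⟩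
  · rw [coeffs_push]
    exact hσ x₁ _
  · obtain ⟨ψ, χ, h⟩ := hall x
    refine ⟨φ₁.symm.trans (ψ.trans (χ.symm.trans φ)), ?_⟩
    rw [← push_eq_push_of_push_eq_push h φ]
    change ((σ.toFun x₁).push φ₁).push _ = _
    rw [← push_trans]
    congr 1
    ext v
    simp

end SymmFourVector

end ConstantType

/-! ## The Wagner connection -/

section Wagner

open FourTensor Topology

variable {M : Type*} [TopologicalSpace M] [ChartedSpace Plane M] [IsManifold (𝓡 2) ∞ M]

namespace SymmFourVector

variable {σ : SymmFourVector M}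

theorem fderiv_mvfderiv_comp_eq_zero {x₀ y : M} (hy : y ∈ frameDomain x₀)
    {G : (Fin 5 → ℝ) → ℝ} (hG : Differentiable ℝ G) {c : ℝ}
    (h : ∀ᶠ z in 𝓝 y, G (fun k ↦ σ.comp x₀ k z) = c) (X₀ : TangentSpace (𝓡 2) y) :
    fderiv ℝ G (fun k ↦ σ.comp x₀ k y) (fun k ↦ mvfderiv (𝓡 2) (σ.comp x₀ k) y X₀) = 0 := by
  rw [← mvfderiv_comp_pi (hG _) (σ.mdifferentiableAt_comp hy),
    Filter.EventuallyEq.mvfderiv_eq (g := fun _ ↦ c) h, mvfderiv_const]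
  rfl

/-- If the absolute invariant is constant, the derivatives of the symbol are tangent to orbits. -/
theorem HasConstantI₀.dI₀_eq_zero (h : σ.HasConstantI₀) {x₀ y : M} (hy : y ∈ frameDomain x₀)
    (X₀ : TangentSpace (𝓡 2) y) :
    BinaryQuartic.dI₀ (fun k ↦ σ.comp x₀ k y)
      (fun k ↦ mvfderiv (𝓡 2) (σ.comp x₀ k) y X₀) = 0 := by
  obtain ⟨c, hc⟩ := h
  set a : Fin 5 → ℝ := fun k ↦ σ.comp x₀ k y with ha
  have hev : ∀ᶠ z in 𝓝 y,
      BinaryQuartic.I₀ (fun k ↦ σ.comp x₀ k z) = BinaryQuartic.I₀ a := by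
    filter_upwards [(isOpen_frameDomain x₀).mem_nhds hy] with z hz
    rw [ha, σ.comp_eq hz, σ.comp_eq hy]
    exact (hc z _).trans (hc y _).symm
  simp only [BinaryQuartic.I₀_eq_iff] at hev
  have hI₂ := BinaryQuartic.differentiable_I₂
  have hI₃ := BinaryQuartic.differentiable_I₃
  rw [BinaryQuartic.dI₀]
  by_cases h₂ : BinaryQuartic.I₂ a = 0
  -- Constancy of `I₀ = ∞` means that `I₂` vanishes near `y`; so `dI₂` kills the derivative, and
  -- both terms of `dI₀` are zero.
  · have h := fderiv_mvfderiv_comp_eq_zero (σ := σ) hy hI₂ (c := 0)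
      (hev.mono fun z hz ↦ (hz.resolve_right fun h ↦ h.2.1 h₂).1) X₀
    rw [BinaryQuartic.fderiv_I₂] at h
    rw [h, h₂]
    ring
  · have hev' := hev.mono fun z hz ↦ (hz.resolve_left fun h ↦ h₂ h.2).2.2
    by_cases h₃ : BinaryQuartic.I₃ a = 0
    · have h := fderiv_mvfderiv_comp_eq_zero (σ := σ) hy hI₃ (c := 0)
        (hev'.mono fun z hz ↦ by simpa [h₃, h₂] using hz) X₀
      rw [BinaryQuartic.fderiv_I₃] at h
      rw [h, h₃]
      ring
    -- With denominators cleared, the differential of this `G` at `a` is `I₃ I₂² dI₀`, and the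
    -- factor in front is nonzero.
    · have h := fderiv_mvfderiv_comp_eq_zero (σ := σ) hy
        (G := fun b ↦ BinaryQuartic.I₃ b ^ 2 * BinaryQuartic.I₂ a ^ 3 -
          BinaryQuartic.I₃ a ^ 2 * BinaryQuartic.I₂ b ^ 3) (by fun_prop) (c := 0)
        (hev'.mono fun z hz ↦ sub_eq_zero.2 hz) X₀
      have hd := (((hI₃ a).hasFDerivAt.pow 2).mul_const (BinaryQuartic.I₂ a ^ 3)).sub
        (((hI₂ a).hasFDerivAt.pow 3).const_mul (BinaryQuartic.I₃ a ^ 2))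
      erw [hd.fderiv] at h
      simp [BinaryQuartic.fderiv_I₂, BinaryQuartic.fderiv_I₃] at h
      have h' : BinaryQuartic.I₃ a * BinaryQuartic.I₂ a ^ 2 ≠ 0 := by positivity
      apply mul_left_cancel₀ h'
      linear_combination h

/-- The connection forms at `x` of the Wagner connection, in the frame centred at `x`. -/
noncomputable def wagnerForm (σ : SymmFourVector M) (x : M) (i j : Fin 2) :
    TangentSpace (𝓡 2) x →L[ℝ] ℝ :=
  -(BinaryQuartic.disc fun k ↦ σ.comp x k x)⁻¹ •
    ∑ k, BinaryQuartic.infActInv (fun k ↦ σ.comp x k x) i j k • mvfderiv (𝓡 2) (σ.comp x k) x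

end SymmFourVector

theorem OneForm.SmoothAt.apply_vectorField {ξ : OneForm M} {x : M} (hξ : ξ.SmoothAt x)
    {Y : VectFld M} (hY : ContMDiffAt (𝓡 2) ((𝓡 2).prod 𝓘(ℝ, Plane)) ∞
      (fun y ↦ TotalSpace.mk' Plane (E := fun y : M ↦ TangentSpace (𝓡 2) y) y (Y y)) x) :
    ContMDiffAt (𝓡 2) 𝓘(ℝ, ℝ) ∞ (fun y ↦ ξ y (Y y)) x := by
  have h : ContMDiffAt (𝓡 2) ((𝓡 2).prod 𝓘(ℝ, ℝ)) ∞
      (fun y ↦ TotalSpace.mk' ℝ (E := Bundle.Trivial M ℝ) y (ξ y (Y y))) x :=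
    ContMDiffAt.clm_bundle_apply (F₁ := Plane) (F₂ := ℝ) (b := fun y : M ↦ y) (v := Y)
      (E₁ := fun y : M ↦ TangentSpace (𝓡 2) y) (E₂ := Bundle.Trivial M ℝ) (ϕ := ξ) hξ hY
  exact (contMDiffAt_totalSpace.1 h).2

/-- The Wagner connection of a symmetric 4-vector. At each point it is given by connection forms
in the frame centred at this point. -/
noncomputable def wagnerConnection (σ : SymmFourVector M) : TangentConnection M where
  toFun Y x := ∑ i, (mvfderiv (𝓡 2) (fun z ↦ frameDual x i z (Y z)) x +
    ∑ j, frameDual x j x (Y x) • σ.wagnerForm x i j).smulRight (frame x i x)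
  isCovariantDerivativeOnUniv :=
    { add := by
        intro Y Y' x hY hY' _
        have h (i : Fin 2) := mvfderiv_fun_add
          ((frameDual_diffAt (mem_frameDomain x) i).apply_vectorField (Y := Y) hY)
          ((frameDual_diffAt (mem_frameDomain x) i).apply_vectorField (Y := Y') hY')
        ext1 X₀
        simp only [Pi.add_apply, map_add, h]
        simp [Fin.sum_univ_two]
        module
      leibniz := by
        intro Y g x hY hg _
        have h (i : Fin 2) := mvfderiv_fun_mul hg
          ((frameDual_diffAt (mem_frameDomain x) i).apply_vectorField (Y := Y) hY)
        ext1 X₀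
        -- The inhomogeneous term of the Leibniz rule, expanded in the frame.
        have hYx : mvfderiv (𝓡 2) g x X₀ • Y x = mvfderiv (𝓡 2) g x X₀ •
            ∑ i, frameDual x i x (Y x) • frame x i x := by
          rw [← eq_sum_frame (mem_frameDomain x)]
        simp only [Pi.smul_apply', map_smul, smul_eq_mul, h]
        simp [Fin.sum_univ_two]
        rw [hYx, Fin.sum_univ_two]
        module }

theorem christoffel_wagnerConnection (σ : SymmFourVector M) (x : M)
    (X₀ : TangentSpace (𝓡 2) x) (i j : Fin 2) :
    (wagnerConnection σ).christoffel x X₀ i j = σ.wagnerForm x i j X₀ := by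
  have hx := mem_frameDomain x
  -- The frame has constant components near its centre, so only the connection forms survive.
  have h (k l : Fin 2) : (fun z ↦ frameDual x k z (frame x l z)) =ᶠ[𝓝 x]
      fun _ ↦ if k = l then (1 : ℝ) else 0 := by
    filter_upwards [(isOpen_frameDomain x).mem_nhds hx] with z hz
    exact frameDual_frame hz k l
  simp only [TangentConnection.christoffel, wagnerConnection, (h _ _).mvfderiv_eq, mvfderiv_const,
    frameDual_frame hx]
  fin_cases i <;> fin_cases j <;> simp [Fin.sum_univ_two, frameDual_frame hx]

/-- Parallelism is a pointwise condition, so it can be checked at the centre of each frame. There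
`infAct` returns minus the derivative of the coefficients, because that derivative is killed by
`dI₀`. -/
theorem wagnerConnection_parallel {σ : SymmFourVector M} (hσ : σ.IsRegular)
    (h : σ.HasConstantI₀) (x : M) (X₀ : TangentSpace (𝓡 2) x) (ξ : Fin 4 → OneForm M)
    (hξ : ∀ i, (ξ i).DiffAt x) : (wagnerConnection σ).derivFourVector σ X₀ hξ = 0 := by
  have hx := mem_frameDomain x
  revert ξ
  rw [(wagnerConnection σ).parallel_iff σ hx X₀]
  have h₁ : (wagnerConnection σ).christoffel x X₀ =
      -(BinaryQuartic.disc fun k ↦ σ.comp x k x)⁻¹ • fun i j ↦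
        ∑ k, BinaryQuartic.infActInv (fun k ↦ σ.comp x k x) i j k *
          mvfderiv (𝓡 2) (σ.comp x k) x X₀ := by
    funext i j
    rw [christoffel_wagnerConnection, SymmFourVector.wagnerForm]
    simp
  rw [h₁, BinaryQuartic.infAct_smul, BinaryQuartic.infAct_infActInv (h.dI₀_eq_zero hx X₀),
    smul_smul, neg_mul, inv_mul_cancel₀ (hσ.disc_comp_ne_zero hx)]
  simp

theorem SymmFourVector.contMDiffAt_comp_pi (σ : SymmFourVector M) (x : M)
    {G : (Fin 5 → ℝ) → ℝ} (hG : ContDiffAt ℝ ∞ G fun k ↦ σ.comp x k x) :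
    ContMDiffAt (𝓡 2) 𝓘(ℝ, ℝ) ∞ (fun y ↦ G fun k ↦ σ.comp x k y) x :=
  hG.contMDiffAt.comp (g := G) x
    (contMDiffAt_pi_space.2 fun k ↦ σ.contMDiffAt_comp (mem_frameDomain x) k)

/-- A parallel connection is smooth. -/
theorem contMDiffAt_cov_of_parallel {cov : TangentConnection M} {σ : SymmFourVector M}
    (hσ : σ.IsRegular)
    (hcov : ∀ (x : M) (X₀ : TangentSpace (𝓡 2) x) (ξ : Fin 4 → OneForm M)
      (hξ : ∀ i, (ξ i).DiffAt x), cov.derivFourVector σ X₀ hξ = 0)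
    {Y : VectFld M} (hY : ContMDiff (𝓡 2) ((𝓡 2).prod 𝓘(ℝ, Plane)) ∞
      (fun y ↦ TotalSpace.mk' Plane (E := fun y : M ↦ TangentSpace (𝓡 2) y) y (Y y))) (x : M)
    (i k : Fin 2) :
    ContMDiffAt (𝓡 2) 𝓘(ℝ, ℝ) ∞ (fun y ↦ frameDual x i y (cov Y y (frame x k y))) x := by
  have hx := mem_frameDomain x
  have hdisc := hσ.disc_comp_ne_zero hx
  have h₁ (i : Fin 2) := (frameDual_smoothAt hx i).apply_vectorField (hY x)
  -- These are the connection coefficients in the single frame centred at `x`, given nearby by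
  -- `christoffel_eq_of_parallel`: rational in the coefficients of `σ`, with nonvanishing
  -- denominator `disc`.
  have hΓ (i j : Fin 2) : ContMDiffAt (𝓡 2) 𝓘(ℝ, ℝ) ∞
      (fun y ↦ -(BinaryQuartic.disc fun k ↦ σ.comp x k y)⁻¹ *
        ∑ l, BinaryQuartic.infActInv (fun k ↦ σ.comp x k y) i j l *
          mvfderiv (𝓡 2) (σ.comp x l) y (frame x k y)) x := by
    have h₂ : ContMDiffAt (𝓡 2) 𝓘(ℝ, ℝ) ∞
        (fun y ↦ -(BinaryQuartic.disc fun k ↦ σ.comp x k y)⁻¹) x := by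
      refine σ.contMDiffAt_comp_pi x (G := fun a ↦ -(BinaryQuartic.disc a)⁻¹) ?_
      refine ContDiffAt.neg (ContDiffAt.inv ?_ hdisc)
      unfold BinaryQuartic.disc BinaryQuartic.I₂ BinaryQuartic.I₃
      fun_prop
    have h₃ (l : Fin 5) : ContMDiffAt (𝓡 2) 𝓘(ℝ, ℝ) ∞
        (fun y ↦ BinaryQuartic.infActInv (fun k ↦ σ.comp x k y) i j l) x := by
      refine σ.contMDiffAt_comp_pi x (G := fun a ↦ BinaryQuartic.infActInv a i j l) ?_
      fin_cases i <;> fin_cases j <;> fin_cases l <;>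
        (simp [BinaryQuartic.infActInv, BinaryQuartic.gradI₀, BinaryQuartic.I₂,
          BinaryQuartic.I₃]; fun_prop)
    have h₄ (l : Fin 5) := (σ.contMDiffAt_comp hx l).mvfderiv_apply (contMDiffAt_frame hx k)
    exact h₂.mul (ContMDiffAt.sum fun l _ ↦ (h₃ l).mul (h₄ l))
  have h₅ := ((h₁ i).mvfderiv_apply (contMDiffAt_frame hx k)).add
    (ContMDiffAt.sum (t := Finset.univ) fun j _ ↦ (hΓ i j).mul (h₁ j))
  apply h₅.congr_of_eventuallyEq
  filter_upwards [(isOpen_frameDomain x).mem_nhds hx] with y hy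
  rw [cov.frameDual_apply_cov hy ((hY y).mdifferentiableAt (by simp))]
  simp only [cov.christoffel_eq_of_parallel hσ (fun ξ X₀ hξ ↦ hcov y X₀ ξ hξ) hy]
  rfl

theorem contMDiffCovariantDerivative_of_parallel {cov : TangentConnection M}
    {σ : SymmFourVector M} (hσ : σ.IsRegular)
    (hcov : ∀ (x : M) (X₀ : TangentSpace (𝓡 2) x) (ξ : Fin 4 → OneForm M)
      (hξ : ∀ i, (ξ i).DiffAt x), cov.derivFourVector σ X₀ hξ = 0) :
    cov.ContMDiffCovariantDerivative ∞ := by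
  refine ⟨⟨fun {Y} hY ↦ ?_⟩⟩
  rw [contMDiffOn_univ] at hY ⊢
  intro x
  have h := contMDiffAt_cov_of_parallel hσ hcov (Y := Y) hY x
  rw [contMDiffAt_hom_bundle]
  refine ⟨contMDiffAt_id, ?_⟩
  -- The endomorphism `X ↦ ∇_X Y` is recovered from its matrix entries in the frame, each of which
  -- is smooth.
  have h' : ContMDiffAt (𝓡 2) 𝓘(ℝ, Plane →L[ℝ] Plane) ∞ (fun y ↦ ∑ i, ∑ k,
      frameDual x i y (cov Y y (frame x k y)) •
        (EuclideanSpace.proj k : Plane →L[ℝ] ℝ).smulRight (stdVec i)) x :=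
    ContMDiffAt.sum fun i _ ↦ ContMDiffAt.sum fun k _ ↦ (h i k).smul contMDiffAt_const
  apply h'.congr_of_eventuallyEq
  filter_upwards [(isOpen_frameDomain x).mem_nhds (mem_frameDomain x)] with y hy
  rw [ContinuousLinearMap.inCoordinates_eq hy hy]
  ext v l
  change frameEquiv x y hy (cov Y y ((frameEquiv x y hy).symm v)) l = _
  have hv : (frameEquiv x y hy).symm v = v 0 • frame x 0 y + v 1 • frame x 1 y := by
    rw [frame_eq hy, frame_eq hy]
    apply (frameEquiv x y hy).injective
    ext m
    fin_cases m <;> simp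
  rw [← coframe_apply, ← frameDual_eq hy, hv]
  fin_cases l <;> simp [Fin.sum_univ_two, mul_comm]

end Wagner

/-- For a regular symmetric 4-vector `σ` on a connected surface: `σ` has constant type iff it has
a Wagner connection, iff `I₀` is constant; and Wagner connections are unique (two of them take the
same value on every vector field `Y` at every point where `Y` is differentiable). -/
theorem mainTheorem2 {M : Type*} [TopologicalSpace M] [T2Space M] [SigmaCompactSpace M]
    [ConnectedSpace M] [ChartedSpace Plane M] [IsManifold (𝓡 2) ∞ M]
    (σ : SymmFourVector M) (hσ : σ.IsRegular) :
    (σ.HasConstantType ↔ ∃ cov : TangentConnection M, cov.IsWagner σ) ∧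
    (σ.HasConstantType ↔ σ.HasConstantI₀) ∧
    (∀ cov cov' : TangentConnection M, cov.IsWagner σ → cov'.IsWagner σ →
      ∀ (x : M) (Y : VectFld M), Y.DiffAt x →
        cov Y x = cov' Y x) := by
  have huniq (cov cov' : TangentConnection M) (h : cov.IsWagner σ) (h' : cov'.IsWagner σ) (x : M)
      (Y : VectFld M) (hY : Y.DiffAt x) : cov Y x = cov' Y x := by
    have hx := mem_frameDomain x
    ext1 X₀
    rw [eq_sum_frame hx (cov Y x X₀), eq_sum_frame hx (cov' Y x X₀)]
    -- Both connections have the coefficients prescribed by `σ` alone, so their components on `Y`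
    -- agree.
    simp only [TangentConnection.frameDual_apply_cov _ hx hY,
      TangentConnection.christoffel_eq_of_parallel hσ (fun ξ X₀ hξ ↦ h.parallel x X₀ ξ hξ) hx,
      TangentConnection.christoffel_eq_of_parallel hσ (fun ξ X₀ hξ ↦ h'.parallel x X₀ ξ hξ) hx]
  refine ⟨⟨fun h ↦ ?_, fun ⟨cov, hcov⟩ ↦ ?_⟩, ⟨fun h ↦ h.hasConstantI₀,
    fun h ↦ h.hasConstantType hσ⟩, huniq⟩
  · have hpar := wagnerConnection_parallel hσ h.hasConstantI₀
    exact ⟨wagnerConnection σ, contMDiffCovariantDerivative_of_parallel hσ hpar, hpar⟩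
  · exact (SymmFourVector.hasConstantI₀_of_isWagner hσ hcov).hasConstantType hσ
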